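/- **Setting.** Labels are element labels (one of them is $root$), attribute names, and the text symbol $\mathtt S$; the sets of element labels and of attribute names are denoted $\mathbf E$ and $\mathbf A$. A *path* is a sequence $l_1.\cdots.l_n$ of labels with $n\ge 1$, $l_1=root$; $Last(p)=l_n$, $Parnt(p)=l_1.\cdots.l_{n-1}$, and $p\cap q$ is the maximal common prefix. $P$ is a finite set of paths, closed under prefixes, in which only the last label of a path may be an attribute name or $\mathtt S$, and which satisfies: (i) if the last label of $p'\in P$ is the $i$-th label of $l_1.\cdots.l_n\in P$, then $l_1.\cdots.l_i=p'$. For paths in $P$ put $Anc(s)=\{q : q$ is a strict prefix of $s\}$ and $Att(s)=\{q\in P : Parnt(q)=s,\ Last(q)\in\mathbf A\}$. An *XML tree* is a finite rooted node-labelled tree with root label $root$ in which only element nodes have children, each node has at most one attribute child for each attribute name and any number of element and text children, and each attribute or text node $v$ carries a string $val(v)$, while $val(v)=v$ for element nodes. $(T,P)$ is *consistent* if (i) holds and, whenever $u$ is the parent of $v$ in $T$, some path in $P$ contains the label of $u$ strictly before the label of $v$. A *path instance* over $l_1.\cdots.l_n$ is a sequence $v_1.\cdots.v_n$ of nodes starting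 at the root with each $v_{i+1}$ a child of $v_i$ and $v_i$ labelled $l_i$; $N(q)$ is the set of final nodes of the path instances over $q$. The *minimal extension* $T_P$ is obtained from $T$ by inserting pairwise different null nodes $\perp$, with $val(\perp)=\perp$: for each node of $T$ the missing ancestors, and for each node (nulls included) the missing descendants, so that each node whose label occurs in a path $q\in P$ lies on a path instance over $q$. A *unary XFD* is a statement $p\to q$ with $p,q\in P$. $T$ *strongly satisfies* it if $p=q$ or the following holds for any two distinct path instances over $q$ in $T_P$, with final nodes $v,v'$, unless $v,v'$ are both non-null and $val(v)=val(v')$. Let $x$ and $y$ be the nodes of the two path instances that lie in $N(p\cap q)$, and let $Nodes(x,p)$ be the set of nodes of $N(p)$ equal to or below $x$. If $Last(p)\in\mathbf E$, then $x\ne y$; otherwise $Nodes(x,p)$ and $Nodes(y,p)$ contain no null and $val(Nodes(x,p))\cap val(Nodes(y,p))=\emptyset$. A finite set $\Sigma$ of unary XFDs *implies* $p\to q$ if every XML tree $T$ with $(T,P)$ consistent that strongly satisfies all of $\Sigma$ strongly satisfies $p\to q$. **Closure algorithm.** Input: $\Sigma$ and $p\in P$. 1. $P^+:=\{p,root\}$.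 2. If $Last(p)\in\mathbf E$, then $P^+:=P^+\cup Anc(p)$. 3. For each $q\in P^+$ do $P^+:=P^+\cup Att(q)$. Put $Unused:=\Sigma$. 4. Repeat until $P^+$ cannot change any more: choose arbitrarily $r\to s\in Unused$ such that some $p_1\in P^+$ has $r\cap s$ as a prefix and is a prefix of $r$ or of $s$, or $r\in P^+$, or $r\cap s=root$; put $P^+:=P^+\cup\{s\}$ and $Unused:=Unused\setminus\{r\to s\}$, and if $Last(s)\in\mathbf E$, also $P^+:=P^+\cup Anc(s)\cup Att(s)$. 5. Output $P^+\cup\bigcup_{q\in P^+}Att(q)$ (step 3 once more). **Theorem.** Let $Last(p)\in\mathbf E$. (a) Every run of the closure algorithm performs at most $|\Sigma|$ iterations of the loop (each XFD is used at most once), and, whatever choices are made, the output of every finished run (and finished runs exist) is exactly $$\{q\in P : p\to q \text{ is implied by } \Sigma\}.$$ (b) The closure, and hence a decision of whether $\Sigma$ implies $p\to q$, is computed in linear time: the deterministic implementation in which a table lists, for each path $k$, the paths $s$ of those $r\to s\in\Sigma$ for which $r\cap s$ is a prefix of $k$ and $k$ is a prefix of $r$ or of $s$, together with the paths in $Att(k)$,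 and in which an agenda initially consisting of $p$ and $root$ receives, whenever a path $k$ is added to $P^+$, the table entry of $k$ and, if $Last(k)\in\mathbf E$, the path $Parnt(k)$, halts with this set after at most $4L|\Sigma|+3|P|+2$ steps, where $L$ bounds the number of labels of the paths in $P$ and a step handles one candidate table entry or one agenda item. If $P$ consists only of prefixes of $p$ and of paths occurring in $\Sigma$, the number of steps is at most $10L(|\Sigma|+1)$. -/

import Mathlib

/-! ### Labels and paths -/

/-- Labels.  The element labels are `root` and `elem e`; `attr a` is an attribute name and `text`
is the symbol `S`. -/
inductive Label (E A : Type*) where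
  | root : Label E A
  | elem : E → Label E A
  | attr : A → Label E A
  | text : Label E A
  deriving DecidableEq

def Label.isElem {E A : Type*} : Label E A → Bool
  | .root => true
  | .elem _ => true
  | .attr _ => false
  | .text => false

def Label.isAttr {E A : Type*} : Label E A → Bool
  | .attr _ => true
  | _ => false

/-- The path `root.l₂.….lₙ` is represented by the list `[l₂, …, lₙ]`; the path `root` is `[]`.
The prefix order on paths is the prefix order `<+:` on lists. -/
abbrev XPath (E A : Type*) := List (Label E A)

/-- A unary XFD `r → s` is the pair `(r, s)`. -/
abbrev XFD (E A : Type*) := XPath E A × XPath E A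

namespace XPath

variable {E A : Type*}

/-- All labels `root, l₂, …, lₙ` of a path. -/
def labels (p : XPath E A) : List (Label E A) := Label.root :: p

/-- `Last(p)`. -/
def last (p : XPath E A) : Label E A := p.getLastD Label.root

/-- `Parnt(p)`, for `p` different from `root`. -/
def parnt (p : XPath E A) : XPath E A := p.dropLast

/-- `p ∩ q`: the maximal common prefix. -/
def meet [DecidableEq E] [DecidableEq A] : XPath E A → XPath E A → XPath E A
  | a :: p, b :: q => if a = b then a :: meet p q else []
  | _, _ => []

/-- `Anc(p)`: the strict prefixes of `p`. -/
def anc [DecidableEq E] [DecidableEq A] (p : XPath E A) : Finset (XPath E A) :=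
  p.inits.toFinset.erase p

/-- `Att(p)`: the paths (of the given set `P` of paths) that end in an attribute and have
parent `p`. -/
def att [DecidableEq E] [DecidableEq A] (P : Finset (XPath E A)) (p : XPath E A) :
    Finset (XPath E A) :=
  P.filter fun q => q.last.isAttr = true ∧ parnt q = p

end XPath

/-- The sets of paths over which XFDs are considered: closed under prefixes, and only the last
label of a path may be an attribute name or `S`. -/
structure IsPathSet {E A : Type*} (P : Finset (XPath E A)) : Prop where
  prefix_mem : ∀ q ∈ P, ∀ t : XPath E A, t <+: q → t ∈ P
  inner_elem : ∀ q ∈ P, ∀ t : XPath E A, t <+: q → t ≠ q → t.last.isElem = true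

/-- First consistency condition: whenever the last label of a path `p'` of `P` occurs in a path
`p` of `P`, the part of `p` up to this occurrence is `p'`. -/
def LabelConsistent {E A : Type*} (P : Finset (XPath E A)) : Prop :=
  ∀ p ∈ P, ∀ p' ∈ P, ∀ t : XPath E A, t <+: p → t.last = p'.last → t = p'

/-! ### XML trees, possibly with marked nulls -/

/-- The data of an extended XML tree `(V ∪ N, lab, ele, att, val, v_r)`; the set `N` of the nodes
that are marked nulls is `null`.  `str v` is the string at a node `v` that is not an element
node. -/
structure XTree (E A : Type*) where
  V : Type
  null : Set V
  lab : V → Label E A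
  ele : V → Option (List V)
  att : V → A → Option V
  str : V → String
  vr : V

namespace XTree

variable {E A : Type*}

/-- `v` is a child (subelement or attribute) of `u`. -/
def Child (T : XTree E A) (u v : T.V) : Prop :=
  (∃ l, T.ele u = some l ∧ v ∈ l) ∨ ∃ a, T.att u a = some v

/-- The laws of an extended XML tree. -/
structure IsExtended (T : XTree E A) : Prop where
  finite : Finite T.V
  lab_vr : T.lab T.vr = Label.root
  vr_not_null : T.vr ∉ T.null
  ele_elem : ∀ v l, T.ele v = some l → (T.lab v).isElem = true
  ele_nodup : ∀ v l, T.ele v = some l → l.Nodup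
  ele_lab : ∀ v l, T.ele v = some l → ∀ w ∈ l, (T.lab w).isElem = true ∨ T.lab w = Label.text
  att_elem : ∀ v a w, T.att v a = some w → (T.lab v).isElem = true
  att_lab : ∀ v a w, T.att v a = some w → T.lab w = Label.attr a
  vr_no_parent : ∀ u, ¬ T.Child u T.vr
  parent_unique : ∀ u u' v, T.Child u v → T.Child u' v → u = u'
  reachable : ∀ v, Relation.ReflTransGen T.Child T.vr v

/-- An XML tree is an extended XML tree without nulls. -/
def IsXML (T : XTree E A) : Prop := T.IsExtended ∧ T.null = ∅

open Classical in
/-- `val`: the string of a text or attribute node; an element node, and a marked null of any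
kind, is its own value. -/
noncomputable def val (T : XTree E A) (v : T.V) : T.V ⊕ String :=
  if (T.lab v).isElem = true ∨ v ∈ T.null then Sum.inl v else Sum.inr (T.str v)

/-- `vs` is a path instance over the path `p`. -/
def IsInstance (T : XTree E A) (p : XPath E A) (vs : List T.V) : Prop :=
  vs.head? = some T.vr ∧ vs.IsChain T.Child ∧ vs.map T.lab = p.labels

/-- `N(p)`: the final nodes of the path instances over `p`. -/
def N (T : XTree E A) (p : XPath E A) : Set T.V :=
  {v | ∃ vs, T.IsInstance p vs ∧ vs.getLast? = some v}

/-- `AAncestor(v, p)`: the nodes of the path instances over `p` that end in `v`. -/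
def aAncestor (T : XTree E A) (v : T.V) (p : XPath E A) : Set T.V :=
  {v' | ∃ vs, T.IsInstance p vs ∧ vs.getLast? = some v ∧ v' ∈ vs}

/-- `Nodes(v, p)`, where `v` is given as the singleton `X = {v}`: the nodes in `N(p)` that lie at
or below `v`. -/
def nodes (T : XTree E A) (X : Set T.V) (p : XPath E A) : Set T.V :=
  {w | w ∈ T.N p ∧ ∃ v ∈ X, v ∈ T.aAncestor w p}

/-- The nodes of the path instance `vs` that are in `N(p)`. -/
def nodeAt (T : XTree E A) (vs : List T.V) (p : XPath E A) : Set T.V :=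
  {v | v ∈ vs ∧ v ∈ T.N p}

/-- The condition for strong satisfaction of `p → q`, evaluated in the tree `T` (which has to be
the minimal extension of the XML tree in question). -/
def Sat [DecidableEq E] [DecidableEq A] (T : XTree E A) (p q : XPath E A) : Prop :=
  p = q ∨
  ∀ vs vs' : List T.V, T.IsInstance q vs → T.IsInstance q vs' → vs ≠ vs' →
    ∀ v v' : T.V, vs.getLast? = some v → vs'.getLast? = some v' →
    ((v ∈ T.null ∧ v' ∈ T.null) ∨ (v ∉ T.null ∧ v' ∈ T.null) ∨ (v ∈ T.null ∧ v' ∉ T.null) ∨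
      (v ∉ T.null ∧ v' ∉ T.null ∧ T.val v ≠ T.val v')) →
    let x := T.nodeAt vs (XPath.meet p q)
    let y := T.nodeAt vs' (XPath.meet p q)
    if p.last.isElem = true then x ≠ y
    else (∀ w ∈ T.nodes x p, w ∉ T.null) ∧ (∀ w ∈ T.nodes y p, w ∉ T.null) ∧
      (T.val '' T.nodes x p) ∩ (T.val '' T.nodes y p) = ∅

/-- Consistency of `(T, P)`. -/
def Consistent (T : XTree E A) (P : Finset (XPath E A)) : Prop :=
  LabelConsistent P ∧
  ∀ u v, T.Child u v → ∃ p ∈ P, ∃ t t' : XPath E A, t <+: t' ∧ t ≠ t' ∧ t' <+: p ∧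
    T.lab u = t.last ∧ T.lab v = t'.last

/-- Every node whose label occurs in a path of `P` lies on a path instance over this path. -/
def IsComplete (T : XTree E A) (P : Finset (XPath E A)) : Prop :=
  ∀ v, ∀ p ∈ P, T.lab v ∈ p.labels → ∃ vs, T.IsInstance p vs ∧ v ∈ vs

/-- `w` is a node that is not null or has a descendant that is not null. -/
def HasProper (T : XTree E A) (w : T.V) : Prop :=
  ∃ v, v ∉ T.null ∧ Relation.ReflTransGen T.Child w v

/-- `T'` is the minimal extension `T_P` of `T`: the nodes of `T` are the nodes of `T'` that are
not null; an edge of `T` becomes a chain whose inner nodes (the missing ancestors of its lower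
end) are nulls; missing descendants are nulls; `T'` is complete; and no null is superfluous or
shared: each lies on a path instance over a path of `P`, a null is inserted as a missing ancestor
for one node only, and a null that is a missing descendant is the only child of its parent with
its label.  The order of siblings plays no role and is left open. -/
structure IsMinimalExtension (P : Finset (XPath E A)) (T T' : XTree E A) : Prop where
  extended : T'.IsExtended
  embedding : ∃ ι : T.V → T'.V, Function.Injective ι ∧ Set.range ι = T'.nullᶜ ∧
    ι T.vr = T'.vr ∧ (∀ v, T'.lab (ι v) = T.lab v) ∧ (∀ v, T'.str (ι v) = T.str v) ∧
    ∀ u v, T.Child u v →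
      ∃ ws : List T'.V, (∀ w ∈ ws, w ∈ T'.null) ∧ (ι u :: (ws ++ [ι v])).IsChain T'.Child
  complete : T'.IsComplete P
  on_path : ∀ v, ∃ p ∈ P, ∃ vs, T'.IsInstance p vs ∧ v ∈ vs
  ancestor_once : ∀ n ∈ T'.null, ∀ c c', T'.Child n c → T'.Child n c' →
    T'.HasProper c → T'.HasProper c' → c = c'
  descendant_once : ∀ n, ¬ T'.HasProper n → ∀ u n', T'.Child u n → T'.Child u n' →
    T'.lab n' = T'.lab n → n' = n

end XTree

/-- `p → q` is implied by `S` (over the set `P` of paths): every XML tree that is consistent with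
`P` and strongly satisfies every XFD of `S` strongly satisfies `p → q`. -/
def Implies {E A : Type*} [DecidableEq E] [DecidableEq A] (P : Finset (XPath E A))
    (S : Finset (XFD E A)) (p q : XPath E A) : Prop :=
  ∀ T T' : XTree E A, T.IsXML → T.Consistent P → T.IsMinimalExtension P T' →
    (∀ f ∈ S, T'.Sat f.1 f.2) → T'.Sat p q

/-! ### The closure algorithm -/

namespace Closure

variable {E A : Type*} [DecidableEq E] [DecidableEq A]

/-- The variables `P⁺` and `Unused`. -/
structure State (E A : Type*) where
  out : Finset (XPath E A)
  unused : Finset (XFD E A)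

/-- Lines 1-3 and the assignment `Unused = Σ`. -/
def start (P : Finset (XPath E A)) (S : Finset (XFD E A)) (p : XPath E A) : State E A :=
  let P₁ : Finset (XPath E A) := {p, []}
  let P₂ := if p.last.isElem = true then P₁ ∪ p.anc else P₁
  ⟨P₂ ∪ P₂.biUnion (XPath.att P), S⟩

/-- The test in lines 4-6 for the XFD `r → s`. -/
def Applicable (out : Finset (XPath E A)) (r s : XPath E A) : Prop :=
  (∃ p₁ ∈ out, XPath.meet r s <+: p₁ ∧ (p₁ <+: r ∨ p₁ <+: s)) ∨ r ∈ out ∨ XPath.meet r s = []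

/-- The new value of `P⁺` after `r → s` is used (line 7 included). -/
def extend (P out : Finset (XPath E A)) (s : XPath E A) : Finset (XPath E A) :=
  let out₁ := out ∪ {s}
  if s.last.isElem = true then out₁ ∪ s.anc ∪ XPath.att P s else out₁

/-- One iteration of the loop that uses an XFD, chosen arbitrarily. -/
def Iteration (P : Finset (XPath E A)) (X Y : State E A) : Prop :=
  ∃ f ∈ X.unused, Applicable X.out f.1 f.2 ∧ Y = ⟨extend P X.out f.2, X.unused.erase f⟩

/-- `Run P n X Y`: `n` iterations lead from `X` to `Y`. -/
inductive Run (P : Finset (XPath E A)) : ℕ → State E A → State E A → Prop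
  | refl (X : State E A) : Run P 0 X X
  | tail {n : ℕ} {X Y Z : State E A} : Run P n X Y → Iteration P Y Z → Run P (n + 1) X Z

/-- The condition `no more changes to P⁺`: no applicable XFD of `S` changes `P⁺`. -/
def Finished (P : Finset (XPath E A)) (S : Finset (XFD E A)) (X : State E A) : Prop :=
  ∀ f ∈ S, Applicable X.out f.1 f.2 → extend P X.out f.2 = X.out

/-- After the loop, line 3 is executed once more. -/
def output (P : Finset (XPath E A)) (X : State E A) : Finset (XPath E A) :=
  X.out ∪ X.out.biUnion (XPath.att P)

/-! ### A deterministic implementation with a step count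

The arbitrary choices are resolved by a table that maps a path `k` to the paths that have to be
added to `P⁺` once `k` is in `P⁺`.  A step handles one item of one of the lists `todo`, `agenda`
with a bounded number of operations on single paths and single dictionary entries; the items
pushed on the agenda in a step are charged when they are handled. -/

structure Config (E A : Type*) where
  /-- candidate table entries `(key, value, accepted)` -/
  todo : List (XPath E A × XPath E A × Bool)
  table : XPath E A → List (XPath E A)
  /-- paths that have to be added to `P⁺` -/
  agenda : List (XPath E A)
  /-- the current `P⁺` -/
  out : Finset (XPath E A)

/-- The candidates: every prefix `k` of `r` or `s` as key for `s`, accepted if `r ∩ s` is a prefix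
of `k`; and `Parnt(q)` as key for every `q` in `P`, accepted if `q` ends in an attribute. -/
noncomputable def candidates (P : Finset (XPath E A)) (S : Finset (XFD E A)) :
    List (XPath E A × XPath E A × Bool) :=
  S.toList.flatMap (fun f => (f.1.inits ++ f.2.inits).map
    fun k => (k, f.2, (XPath.meet f.1 f.2).isPrefixOf k)) ++
  P.toList.map (fun q => (q.parnt, q, q.last.isAttr))

noncomputable def Config.start (P : Finset (XPath E A)) (S : Finset (XFD E A)) (p : XPath E A) :
    Config E A :=
  ⟨candidates P S, fun _ => [], [p, []], ∅⟩

def Config.step (c : Config E A) : Config E A :=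
  match c.todo, c.agenda with
  | (k, s, b) :: t, _ =>
    { c with todo := t, table := if b = true then Function.update c.table k (s :: c.table k)
                                 else c.table }
  | [], q :: g =>
    if q ∈ c.out then { c with agenda := g }
    else { c with
            out := insert q c.out
            agenda := (if q.last.isElem = true then [q.parnt] else []) ++ c.table q ++ g }
  | [], [] => c

def Config.Halted (c : Config E A) : Prop := c.todo = [] ∧ c.agenda = []

end Closure

/-! Call a set `C ⊆ P` of paths closed (`IsClosure`) if it contains `p` and root, contains the
parents of its element paths and the attribute children of its members, and contains `s` whenever `r
→ s` is in `S` and some `k ∈ C` extends `r ∩ s` and is a prefix of `r` or of `s`. A closed set all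
of whose members are implied by `p` must be the set of all implied paths (`IsClosure.mem_iff`),
since every closed set contains the implied paths. Hence it suffices that the rules are sound, that
closed sets yield counterexamples, and that runs and implementation end in a sound closed set.

Soundness: since `p` ends in an element label, `p → q` says that distinct nodes over `q` that do not
agree have no common ancestor over `p ∩ q`. The essential case is `XTree.Sat.rule`: a violation of
`p → s` is moved upwards by `r → s` to a violation of `p → r ∩ s`, or sideways to a violation of `p
→ r`.

Completeness: for closed `C`, take a tree with a single node for each path that lies in `C` together
with its parent, and two copies for every other path of `P`. Attribute and text nodes over paths in
`C` share one string; over other paths the copies differ. If `q ∉ C`, the two nodes over `q`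
disagree and lie below the single node over `p ∩ q`, so `p → q` fails (`counterTree_not_sat`). If `r
→ s` is in `S` and `s ∉ C`, then neither `r ∩ s` nor `r` is in `C`, so the two copies separate at `r
∩ s` or above and their values over `r` differ (`counterTree_sat`). The tree is complete, hence its
own minimal extension.

The step count is amortized: a potential linear in the input drops with every step
(`Config.potential_step`). -/

namespace XPath

/-! ### Prefixes, parents and meets of paths -/

variable {E A : Type*}

@[simp] theorem last_concat (k : XPath E A) (l : Label E A) : last (k ++ [l]) = l := by
  simp [last]

@[simp] theorem parnt_concat (k : XPath E A) (l : Label E A) : parnt (k ++ [l]) = k := by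
  simp [parnt]

theorem parnt_append_last {k : XPath E A} (h : k ≠ []) : k.parnt ++ [k.last] = k := by
  obtain rfl | ⟨k, l, rfl⟩ := List.eq_nil_or_concat' k
  · exact absurd rfl h
  · simp

theorem parnt_prefix (k : XPath E A) : k.parnt <+: k := List.dropLast_prefix k

theorem last_mem_labels (k : XPath E A) : k.last ∈ k.labels := by
  obtain rfl | ⟨k, l, rfl⟩ := List.eq_nil_or_concat' k <;> simp [last, labels]

theorem prefix_parnt {t k : XPath E A} (h : t <+: k) (hne : t ≠ k) : t <+: k.parnt := by
  obtain rfl | ⟨k, l, rfl⟩ := List.eq_nil_or_concat' k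
  · exact absurd (List.prefix_nil.1 h) hne
  · rcases List.prefix_concat_iff.1 h with h | h
    · exact absurd h hne
    · simpa using h

theorem mem_labels_iff {k : XPath E A} {l : Label E A} :
    l ∈ k.labels ↔ ∃ t : XPath E A, t <+: k ∧ t.last = l := by
  constructor
  · induction k using List.reverseRecOn with
    | nil => intro h; exact ⟨[], List.prefix_rfl, by simpa [labels, last, eq_comm] using h⟩
    | append_singleton k a ih =>
      intro h
      have h' : l ∈ labels k ∨ l = a := by simpa [labels, or_assoc] using h
      rcases h' with h' | rfl
      · obtain ⟨t, ht, e⟩ := ih h'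
        exact ⟨t, ht.trans (List.prefix_append _ _), e⟩
      · exact ⟨_, List.prefix_rfl, by simp⟩
  · rintro ⟨t, ht, rfl⟩
    have h := last_mem_labels t
    obtain ⟨u, rfl⟩ := ht
    simp only [labels, List.mem_cons, List.mem_append] at h ⊢
    tauto

section
variable [DecidableEq E] [DecidableEq A]

theorem prefix_meet_iff {t p q : XPath E A} : t <+: meet p q ↔ t <+: p ∧ t <+: q := by
  induction p generalizing t q with
  | nil => simp only [meet, List.prefix_nil]; exact ⟨fun h => by simp [h], fun h => h.1⟩
  | cons a p ih =>
    cases q with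
    | nil => simp only [meet, List.prefix_nil]; exact ⟨fun h => by simp [h], fun h => h.2⟩
    | cons b q =>
      cases t with
      | nil => simp
      | cons c t =>
        by_cases h : a = b
        · subst h
          simp only [meet, if_true, List.cons_prefix_cons, ih]
          tauto
        · simp only [meet, h, if_false, List.prefix_nil, List.cons_prefix_cons]
          constructor
          · intro h; cases h
          · rintro ⟨⟨rfl, _⟩, rfl, _⟩; exact absurd rfl h

theorem meet_prefix_left (p q : XPath E A) : meet p q <+: p :=
  (prefix_meet_iff.1 List.prefix_rfl).1

theorem meet_prefix_right (p q : XPath E A) : meet p q <+: q :=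
  (prefix_meet_iff.1 List.prefix_rfl).2

theorem meet_self (p : XPath E A) : meet p p = p :=
  (meet_prefix_left p p).eq_of_length_le (prefix_meet_iff.2 ⟨List.prefix_rfl, List.prefix_rfl⟩).length_le

theorem mem_anc {t k : XPath E A} : t ∈ anc k ↔ t ≠ k ∧ t <+: k := by
  simp [anc]

theorem mem_att {P : Finset (XPath E A)} {t k : XPath E A} :
    t ∈ att P k ↔ t ∈ P ∧ t.last.isAttr = true ∧ t.parnt = k := by
  simp [att]

end

theorem not_isElem_of_isAttr {l : Label E A} (h : l.isAttr = true) : ¬ l.isElem = true := by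
  cases l <;> simp_all [Label.isAttr, Label.isElem]

theorem ne_nil_of_isAttr {k : XPath E A} (h : k.last.isAttr = true) : k ≠ [] := by
  rintro rfl; simp [last, Label.isAttr] at h

end XPath

namespace IsPathSet

variable {E A : Type*} {P : Finset (XPath E A)}

theorem isElem_of_prefix (hP : IsPathSet P) {t k : XPath E A} (hk : k ∈ P)
    (he : k.last.isElem = true) (h : t <+: k) : t.last.isElem = true := by
  by_cases e : t = k
  · rwa [e]
  · exact hP.inner_elem k hk t h e

theorem eq_of_prefix (hP : IsPathSet P) {t k : XPath E A} (hk : k ∈ P)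
    (he : ¬ t.last.isElem = true) (h : t <+: k) : t = k := by
  by_contra e
  exact he (hP.inner_elem k hk t h e)

theorem isElem_parnt (hP : IsPathSet P) {k : XPath E A} (hk : k ∈ P) :
    k.parnt.last.isElem = true := by
  by_cases h : k = []
  · subst h; rfl
  · refine hP.inner_elem k hk _ k.parnt_prefix fun e => ?_
    have := congrArg List.length (XPath.parnt_append_last h)
    rw [e] at this
    simp at this

end IsPathSet

/-! ### Path instances and the ancestor order of a tree -/

namespace XTree

variable {E A : Type*} {T : XTree E A}

theorem isInstance_nil (hT : T.IsExtended) {vs : List T.V} : T.IsInstance [] vs ↔ vs = [T.vr] := by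
  constructor
  · rintro ⟨h1, -, h3⟩
    obtain _ | ⟨a, _ | ⟨b, vs⟩⟩ := vs <;> simp_all [XPath.labels]
  · rintro rfl
    simp [IsInstance, XPath.labels, hT.lab_vr]

/-- Inductions on paths peel off the last label, because going up is deterministic: a node has one
parent but many children. -/
theorem isInstance_concat {k : XPath E A} {l : Label E A} {vs : List T.V} :
    T.IsInstance (k ++ [l]) vs ↔ ∃ ws u v, T.IsInstance k ws ∧ ws.getLast? = some u ∧
      T.Child u v ∧ T.lab v = l ∧ vs = ws ++ [v] := by
  constructor
  · rintro ⟨h1, h2, h3⟩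
    rw [XPath.labels, ← List.cons_append, List.map_eq_append_iff] at h3
    obtain ⟨ws, xs, rfl, h4, h5⟩ := h3
    obtain ⟨v, rfl, h6⟩ : ∃ v, xs = [v] ∧ T.lab v = l := by
      obtain _ | ⟨a, _ | ⟨b, xs⟩⟩ := xs <;> simp_all
    have hne : ws ≠ [] := by rintro rfl; simp at h4
    obtain ⟨h7, -, h8⟩ := List.isChain_append.1 h2
    refine ⟨ws, ws.getLast hne, v, ⟨?_, h7, h4⟩, List.getLast?_eq_some_getLast hne, ?_, h6, rfl⟩
    · rwa [List.head?_append_of_ne_nil _ hne] at h1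
    · exact h8 _ (List.getLast?_eq_some_getLast hne) _ rfl
  · rintro ⟨ws, u, v, ⟨h1, h2, h3⟩, hu, hc, hl, rfl⟩
    have hne : ws ≠ [] := by rintro rfl; simp at hu
    refine ⟨by rwa [List.head?_append_of_ne_nil _ hne], ?_, by simp [h3, hl, XPath.labels]⟩
    refine List.isChain_append.2 ⟨h2, by simp, fun x hx y hy => ?_⟩
    simp only [hu, List.head?_cons, Option.mem_def, Option.some.injEq] at hx hy
    subst hx hy
    exact hc

theorem mem_N_nil (hT : T.IsExtended) {v : T.V} : v ∈ T.N [] ↔ v = T.vr := by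
  simp [N, isInstance_nil hT, eq_comm]

theorem mem_N_concat {k : XPath E A} {l : Label E A} {v : T.V} :
    v ∈ T.N (k ++ [l]) ↔ ∃ u ∈ T.N k, T.Child u v ∧ T.lab v = l := by
  constructor
  · rintro ⟨vs, h, hv⟩
    obtain ⟨ws, u, w, h1, h2, h3, h4, rfl⟩ := isInstance_concat.1 h
    simp only [List.getLast?_append, List.getLast?_singleton, Option.some_or, Option.some.injEq] at hv
    subst hv
    exact ⟨u, ⟨ws, h1, h2⟩, h3, h4⟩
  · rintro ⟨u, ⟨ws, h1, h2⟩, h3, h4⟩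
    exact ⟨ws ++ [v], isInstance_concat.2 ⟨ws, u, v, h1, h2, h3, h4, rfl⟩, by simp⟩

theorem lab_of_mem_N {k : XPath E A} {v : T.V} (hT : T.IsExtended) (h : v ∈ T.N k) :
    T.lab v = k.last := by
  obtain rfl | ⟨k, l, rfl⟩ := List.eq_nil_or_concat' k
  · rw [(mem_N_nil hT).1 h, hT.lab_vr]; rfl
  · obtain ⟨u, -, -, h⟩ := mem_N_concat.1 h
    simpa using h

theorem isInstance_unique (hT : T.IsExtended) {k k' : XPath E A} {vs vs' : List T.V} {v : T.V}
    (h : T.IsInstance k vs) (hv : vs.getLast? = some v) (h' : T.IsInstance k' vs')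
    (hv' : vs'.getLast? = some v) : k = k' ∧ vs = vs' := by
  induction k using List.reverseRecOn generalizing k' vs vs' v with
  | nil =>
    rw [isInstance_nil hT] at h
    subst h
    obtain rfl | ⟨k', l', rfl⟩ := List.eq_nil_or_concat' k'
    · exact ⟨rfl, ((isInstance_nil hT).1 h').symm⟩
    · obtain ⟨ws, u, w, h1, h2, h3, h4, rfl⟩ := isInstance_concat.1 h'
      simp at hv hv'
      subst hv hv'
      exact absurd h3 (hT.vr_no_parent _)
  | append_singleton k l ih =>
    obtain ⟨ws, u, w, h1, h2, h3, h4, rfl⟩ := isInstance_concat.1 h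
    simp only [List.getLast?_append, List.getLast?_singleton, Option.some_or, Option.some.injEq] at hv
    subst hv
    obtain rfl | ⟨k', l', rfl⟩ := List.eq_nil_or_concat' k'
    · rw [isInstance_nil hT] at h'
      subst h'
      simp at hv'
      subst hv'
      exact absurd h3 (hT.vr_no_parent _)
    · obtain ⟨ws', u', w', h1', h2', h3', h4', rfl⟩ := isInstance_concat.1 h'
      simp only [List.getLast?_append, List.getLast?_singleton, Option.some_or,
        Option.some.injEq] at hv'
      subst hv'
      obtain rfl := hT.parent_unique _ _ _ h3 h3'
      obtain ⟨rfl, rfl⟩ := ih h1 h2 h1' h2'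
      exact ⟨by rw [← h4, h4'], rfl⟩

theorem mem_N_unique (hT : T.IsExtended) {k k' : XPath E A} {v : T.V} (h : v ∈ T.N k)
    (h' : v ∈ T.N k') : k = k' := by
  obtain ⟨vs, h1, h2⟩ := h
  obtain ⟨vs', h1', h2'⟩ := h'
  exact (isInstance_unique hT h1 h2 h1' h2').1

/-- `v` is equal to or below `u`. -/
def Below (T : XTree E A) (u v : T.V) : Prop := Relation.ReflTransGen T.Child u v

/-- By uniqueness of parents, an instance ending in `v` is the list of all ancestors of `v`. This
allows instances to be replaced by their final nodes and the relation `Below`. -/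
theorem mem_instance_iff (hT : T.IsExtended) {k : XPath E A} {vs : List T.V} {u v : T.V}
    (h : T.IsInstance k vs) (hv : vs.getLast? = some v) : u ∈ vs ↔ T.Below u v := by
  induction k using List.reverseRecOn generalizing vs v with
  | nil =>
    rw [isInstance_nil hT] at h
    subst h
    simp only [List.getLast?_singleton, Option.some.injEq] at hv
    subst hv
    simp only [List.mem_singleton]
    constructor
    · rintro rfl; exact .refl
    · intro h
      rcases Relation.ReflTransGen.cases_tail h with h | ⟨w, -, h⟩
      · exact h.symm
      · exact absurd h (hT.vr_no_parent _)
  | append_singleton k l ih =>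
    obtain ⟨ws, x, w, h1, h2, h3, h4, rfl⟩ := isInstance_concat.1 h
    simp only [List.getLast?_append, List.getLast?_singleton, Option.some_or, Option.some.injEq] at hv
    subst hv
    rw [List.mem_append, ih h1 h2, List.mem_singleton]
    constructor
    · rintro (h | rfl)
      · exact h.tail h3
      · exact .refl
    · intro h
      rcases Relation.ReflTransGen.cases_tail h with h | ⟨y, h, hy⟩
      · exact .inr h.symm
      · obtain rfl := hT.parent_unique _ _ _ h3 hy
        exact .inl h

theorem nodeAt_eq (hT : T.IsExtended) {k t : XPath E A} {vs : List T.V} {v : T.V}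
    (h : T.IsInstance k vs) (hv : vs.getLast? = some v) :
    T.nodeAt vs t = {u | u ∈ T.N t ∧ T.Below u v} := by
  ext u
  simp only [nodeAt, Set.mem_ofPred_eq, mem_instance_iff hT h hv]
  exact and_comm

theorem mem_nodes (hT : T.IsExtended) {k : XPath E A} {X : Set T.V} {w : T.V} :
    w ∈ T.nodes X k ↔ w ∈ T.N k ∧ ∃ u ∈ X, T.Below u w := by
  simp only [nodes, Set.mem_ofPred_eq]
  refine and_congr_right fun ⟨vs, h, hv⟩ => exists_congr fun u => and_congr_right fun _ => ?_
  constructor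
  · rintro ⟨vs, h, hv, hu⟩
    exact (mem_instance_iff hT h hv).1 hu
  · intro hu
    exact ⟨vs, h, hv, (mem_instance_iff hT h hv).2 hu⟩

theorem Below.prefix (hT : T.IsExtended) {t k : XPath E A} {u v : T.V} (hu : u ∈ T.N t)
    (hv : v ∈ T.N k) (h : T.Below u v) : t <+: k := by
  induction h generalizing k with
  | refl => rw [mem_N_unique hT hu hv]
  | @tail w v _ hc ih =>
    obtain rfl | ⟨k, l, rfl⟩ := List.eq_nil_or_concat' k
    · rw [mem_N_nil hT] at hv
      subst hv
      exact absurd hc (hT.vr_no_parent _)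
    · obtain ⟨w', hw', hc', -⟩ := mem_N_concat.1 hv
      obtain rfl := hT.parent_unique _ _ _ hc hc'
      exact (ih hw').trans (List.prefix_append _ _)

theorem Below.eq (hT : T.IsExtended) {k : XPath E A} {u v : T.V} (hu : u ∈ T.N k)
    (hv : v ∈ T.N k) (h : T.Below u v) : u = v := by
  rcases Relation.ReflTransGen.cases_tail h with h | ⟨w, h, hc⟩
  · exact h.symm
  · obtain rfl | ⟨k, l, rfl⟩ := List.eq_nil_or_concat' k
    · rw [mem_N_nil hT] at hv
      subst hv
      exact absurd hc (hT.vr_no_parent _)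
    · obtain ⟨w', hw', hc', -⟩ := mem_N_concat.1 hv
      obtain rfl := hT.parent_unique _ _ _ hc hc'
      have := (Below.prefix hT hu hw' h).length_le
      simp at this

theorem exists_above {t k : XPath E A} {v : T.V} (hv : v ∈ T.N k) (h : t <+: k) :
    ∃ u ∈ T.N t, T.Below u v := by
  induction k using List.reverseRecOn generalizing v with
  | nil => rw [List.prefix_nil] at h; subst h; exact ⟨v, hv, .refl⟩
  | append_singleton k l ih =>
    rcases List.prefix_concat_iff.1 h with rfl | h
    · exact ⟨v, hv, .refl⟩
    · obtain ⟨w, hw, hc, -⟩ := mem_N_concat.1 hv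
      obtain ⟨u, hu, hb⟩ := ih hw h
      exact ⟨u, hu, hb.tail hc⟩

theorem below_total (hT : T.IsExtended) {u w v : T.V} (h : T.Below u v) (h' : T.Below w v) :
    T.Below u w ∨ T.Below w u := by
  induction h with
  | refl => exact .inr h'
  | @tail x v h1 hc ih =>
    rcases Relation.ReflTransGen.cases_tail h' with rfl | ⟨y, h, hy⟩
    · exact .inl (h1.tail hc)
    · obtain rfl := hT.parent_unique _ _ _ hc hy
      exact ih h

theorem above_unique (hT : T.IsExtended) {t : XPath E A} {u w v : T.V} (hu : u ∈ T.N t)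
    (hw : w ∈ T.N t) (h : T.Below u v) (h' : T.Below w v) : u = w := by
  rcases below_total hT h h' with h | h
  · exact Below.eq hT hu hw h
  · exact (Below.eq hT hw hu h).symm

theorem above_of_prefix (hT : T.IsExtended) {t k : XPath E A} {u w v : T.V} (hu : u ∈ T.N t)
    (hw : w ∈ T.N k) (h : T.Below u v) (h' : T.Below w v) (hp : t <+: k) : T.Below u w := by
  obtain ⟨x, hx, hb⟩ := exists_above hw hp
  rwa [above_unique hT hu hx h (hb.trans h')]

/-- The only use of completeness in the soundness part: the sets `Nodes(u, k)` are nonempty. -/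
theorem exists_below {P : Finset (XPath E A)} (hT : T.IsExtended) (hc : T.IsComplete P)
    {t k : XPath E A} {u : T.V} (hk : k ∈ P) (hu : u ∈ T.N t) (h : t <+: k) :
    ∃ v ∈ T.N k, T.Below u v := by
  obtain ⟨vs, h1, h2⟩ := hc u k hk
    (XPath.mem_labels_iff.2 ⟨t, h, (lab_of_mem_N hT hu).symm⟩)
  have hne : vs ≠ [] := List.ne_nil_of_mem h2
  exact ⟨vs.getLast hne, ⟨vs, h1, List.getLast?_eq_some_getLast hne⟩,
    (mem_instance_iff hT h1 (List.getLast?_eq_some_getLast hne)).1 h2⟩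

/-- `v` and `w` are proper nodes with the same value. -/
def Agree (T : XTree E A) (v w : T.V) : Prop := v ∉ T.null ∧ w ∉ T.null ∧ T.val v = T.val w

theorem not_agree_iff {v w : T.V} : ¬ T.Agree v w ↔
    ((v ∈ T.null ∧ w ∈ T.null) ∨ (v ∉ T.null ∧ w ∈ T.null) ∨ (v ∈ T.null ∧ w ∉ T.null) ∨
      (v ∉ T.null ∧ w ∉ T.null ∧ T.val v ≠ T.val w)) := by
  unfold Agree
  tauto

theorem not_agree_of_isElem {v w : T.V} (hv : (T.lab v).isElem = true) (h : v ≠ w) :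
    ¬ T.Agree v w := by
  rintro ⟨-, -, e⟩
  unfold val at e
  split_ifs at e <;> simp_all

/-! ### Strong satisfaction in terms of nodes and common ancestors -/

section
variable [DecidableEq E] [DecidableEq A]

/-- The set `nodeAt` of an instance is a singleton, so `x ≠ y` means that no node over `p ∩ q` is
above both ends. The trivial case `p = q` is absorbed: there the common ancestor would be equal to
both `v` and `w`. -/
theorem sat_iff_of_isElem (hT : T.IsExtended) {p q : XPath E A} (hp : p.last.isElem = true) :
    T.Sat p q ↔ ∀ v ∈ T.N q, ∀ w ∈ T.N q, v ≠ w → ¬ T.Agree v w →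
      ∀ u ∈ T.N (XPath.meet p q), T.Below u v → ¬ T.Below u w := by
  constructor
  · rintro (rfl | h) v hv w hw hvw ha u hu hb hb'
    · rw [XPath.meet_self] at hu
      exact hvw ((Below.eq hT hu hv hb).symm.trans (Below.eq hT hu hw hb'))
    · obtain ⟨vs, h1, h2⟩ := hv
      obtain ⟨ws, h1', h2'⟩ := hw
      have hne : vs ≠ ws := by
        rintro rfl
        exact hvw (Option.some.inj (h2.symm.trans h2'))
      have := h vs ws h1 h1' hne v w h2 h2' (not_agree_iff.1 ha)
      simp only [hp, if_true, nodeAt_eq hT h1 h2, nodeAt_eq hT h1' h2'] at this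
      refine this (Set.ext fun x => ⟨fun hx => ?_, fun hx => ?_⟩)
      · rw [above_unique hT hx.1 hu hx.2 hb]; exact ⟨hu, hb'⟩
      · rw [above_unique hT hx.1 hu hx.2 hb']; exact ⟨hu, hb⟩
  · refine fun h => .inr fun vs ws h1 h1' hne v w h2 h2' ha => ?_
    simp only [hp, if_true, nodeAt_eq hT h1 h2, nodeAt_eq hT h1' h2']
    intro e
    have hvw : v ≠ w := by
      rintro rfl
      exact hne (isInstance_unique hT h1 h2 h1' h2').2
    obtain ⟨u, hu, hb⟩ := exists_above (T := T) ⟨vs, h1, h2⟩ (XPath.meet_prefix_right p q)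
    have hu' : u ∈ {u | u ∈ T.N (XPath.meet p q) ∧ T.Below u w} := e ▸ ⟨hu, hb⟩
    exact h v ⟨vs, h1, h2⟩ w ⟨ws, h1', h2'⟩ hvw (not_agree_iff.2 ha) u hu hb hu'.2

/-- Here `p = q` has to be excluded: the right-hand side would then fail as soon as one of two
distinct nodes over `q` is null. -/
theorem sat_iff_of_not_isElem (hT : T.IsExtended) {p q : XPath E A}
    (hp : ¬ p.last.isElem = true) (hpq : p ≠ q) :
    T.Sat p q ↔ ∀ v ∈ T.N q, ∀ w ∈ T.N q, v ≠ w → ¬ T.Agree v w →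
      ∀ x ∈ T.N (XPath.meet p q), ∀ y ∈ T.N (XPath.meet p q), T.Below x v → T.Below y w →
      (∀ v' ∈ T.N p, T.Below x v' → v' ∉ T.null) ∧ (∀ w' ∈ T.N p, T.Below y w' → w' ∉ T.null) ∧
      ∀ v' ∈ T.N p, ∀ w' ∈ T.N p, T.Below x v' → T.Below y w' → T.val v' ≠ T.val w' := by
  have key : ∀ {v x : T.V} {vs : List T.V}, T.IsInstance q vs → vs.getLast? = some v →
      x ∈ T.N (XPath.meet p q) → T.Below x v → T.nodeAt vs (XPath.meet p q) = {x} := by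
    intro v x vs h1 h2 hx hb
    rw [nodeAt_eq hT h1 h2]
    exact Set.ext fun u => ⟨fun hu => above_unique hT hu.1 hx hu.2 hb, fun hu => by
      rw [Set.mem_singleton_iff] at hu; subst hu; exact ⟨hx, hb⟩⟩
  have hn : ∀ {x u : T.V}, u ∈ T.nodes {x} p ↔ u ∈ T.N p ∧ T.Below x u := by
    intro x u
    simp [mem_nodes hT]
  constructor
  · rintro (h | h) v hv w hw hvw ha x hx y hy hb hb'
    · exact absurd h hpq
    · obtain ⟨vs, h1, h2⟩ := hv
      obtain ⟨ws, h1', h2'⟩ := hw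
      have hne : vs ≠ ws := by
        rintro rfl
        exact hvw (Option.some.inj (h2.symm.trans h2'))
      have := h vs ws h1 h1' hne v w h2 h2' (not_agree_iff.1 ha)
      simp only [hp, key h1 h2 hx hb, key h1' h2' hy hb'] at this
      obtain ⟨a, b, c⟩ := this
      refine ⟨fun v' h h' => a v' (hn.2 ⟨h, h'⟩), fun v' h h' => b v' (hn.2 ⟨h, h'⟩), ?_⟩
      intro v' h3 w' h4 h5 h6 e
      have : T.val v' ∈ T.val '' T.nodes {x} p ∩ T.val '' T.nodes {y} p :=
        ⟨⟨v', hn.2 ⟨h3, h5⟩, rfl⟩, ⟨w', hn.2 ⟨h4, h6⟩, e.symm⟩⟩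
      rw [c] at this
      exact this
  · refine fun h => .inr fun vs ws h1 h1' hne v w h2 h2' ha => ?_
    have hvw : v ≠ w := by
      rintro rfl
      exact hne (isInstance_unique hT h1 h2 h1' h2').2
    obtain ⟨x, hx, hb⟩ := exists_above (T := T) ⟨vs, h1, h2⟩ (XPath.meet_prefix_right p q)
    obtain ⟨y, hy, hb'⟩ := exists_above (T := T) ⟨ws, h1', h2'⟩ (XPath.meet_prefix_right p q)
    obtain ⟨a, b, c⟩ := h v ⟨vs, h1, h2⟩ w ⟨ws, h1', h2'⟩ hvw (not_agree_iff.2 ha) x hx y hy hb hb'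
    simp only [hp, key h1 h2 hx hb, key h1' h2' hy hb']
    refine ⟨fun v' h => a v' (hn.1 h).1 (hn.1 h).2, fun v' h => b v' (hn.1 h).1 (hn.1 h).2, ?_⟩
    refine Set.eq_empty_of_forall_notMem ?_
    rintro _ ⟨⟨v', h3, rfl⟩, ⟨w', h4, e⟩⟩
    exact c v' (hn.1 h3).1 w' (hn.1 h4).1 (hn.1 h3).2 (hn.1 h4).2 e.symm

end

end XTree

/-! ### Soundness of the closure rules -/

section Soundness

variable {E A : Type*} [DecidableEq E] [DecidableEq A] {P : Finset (XPath E A)}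
  {S : Finset (XFD E A)} {p : XPath E A}

open XPath XTree

theorem implies_self : Implies P S p p := fun _ _ _ _ _ _ => .inl rfl

theorem implies_nil (hpE : p.last.isElem = true) : Implies P S p [] := by
  intro T T' _ _ hT _
  rw [sat_iff_of_isElem hT.extended hpE]
  intro v hv w hw hvw
  rw [mem_N_nil hT.extended] at hv hw
  exact absurd (hv.trans hw.symm) hvw

namespace XTree

variable {T : XTree E A}

/-- If `t` is a prefix of `p`, a common ancestor over `p ∩ t = t` equals both nodes. Otherwise `p ∩
k = p ∩ t`, and a violation at `t` extends down to `k`, where distinct nodes cannot agree because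
they are element nodes. -/
theorem Sat.prefix (hT : T.IsExtended) (hc : T.IsComplete P) (hpE : p.last.isElem = true)
    {k t : XPath E A} (hk : k ∈ P) (hkE : k.last.isElem = true) (h : T.Sat p k) (ht : t <+: k) :
    T.Sat p t := by
  rw [sat_iff_of_isElem hT hpE] at h ⊢
  intro v hv w hw hvw ha u hu hb hb'
  by_cases htp : t <+: p
  · have e : meet p t = t := (meet_prefix_right p t).eq_of_length_le
      (prefix_meet_iff.2 ⟨htp, List.prefix_rfl⟩).length_le
    rw [e] at hu
    exact hvw ((Below.eq hT hu hv hb).symm.trans (Below.eq hT hu hw hb'))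
  · have e : meet p k = meet p t := by
      have h1 : meet p t <+: meet p k :=
        prefix_meet_iff.2 ⟨meet_prefix_left _ _, (meet_prefix_right _ _).trans ht⟩
      rcases List.prefix_or_prefix_of_prefix (meet_prefix_right p k) ht with h2 | h2
      · exact (prefix_meet_iff.2 ⟨meet_prefix_left _ _, h2⟩).eq_of_length_le h1.length_le
      · exact absurd (h2.trans (meet_prefix_left _ _)) htp
    obtain ⟨v', hv', hvb⟩ := exists_below hT hc hk hv ht
    obtain ⟨w', hw', hwb⟩ := exists_below hT hc hk hw ht
    have hne : v' ≠ w' := by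
      rintro rfl
      exact hvw (above_unique hT hv hw hvb hwb)
    have hv'E : (T.lab v').isElem = true := by rwa [lab_of_mem_N hT hv']
    rw [← e] at hu
    exact h v' hv' w' hw' hne (not_agree_of_isElem hv'E hne) u hu (hb.trans hvb) (hb'.trans hwb)

/-- Distinct attribute nodes over one path have distinct parents. These are element nodes, so they
do not agree, and `p ∩ k` is unchanged when the attribute is cut off. -/
theorem Sat.att (hP : IsPathSet P) (hT : T.IsExtended) (hp : p ∈ P) (hpE : p.last.isElem = true)
    {k : XPath E A} (hk : k ∈ P) (hkA : k.last.isAttr = true) (h : T.Sat p k.parnt) :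
    T.Sat p k := by
  have hkE := hP.isElem_parnt hk
  obtain ⟨t, l, rfl⟩ := (List.eq_nil_or_concat' k).resolve_left (ne_nil_of_isAttr hkA)
  rw [parnt_concat] at h hkE
  rw [last_concat] at hkA
  rw [sat_iff_of_isElem hT hpE] at h ⊢
  intro v hv w hw hvw ha u hu hb hb'
  obtain ⟨v', hv', hvc, hvl⟩ := mem_N_concat.1 hv
  obtain ⟨w', hw', hwc, hwl⟩ := mem_N_concat.1 hw
  obtain ⟨a, rfl⟩ : ∃ a, l = Label.attr a := by
    cases l <;> simp_all [Label.isAttr]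
  -- A child labelled by an attribute is a value of the partial function `att`, hence determined by
  -- its parent and the name.
  have key : ∀ {x y : T.V}, T.Child x y → T.lab y = Label.attr a → T.att x a = some y := by
    rintro x y (⟨l, hl, hy⟩ | ⟨b, hb⟩) e
    · rcases hT.ele_lab _ _ hl _ hy with h | h <;> rw [e] at h <;> simp [Label.isElem] at h
    · have := hT.att_lab _ _ _ hb
      rw [e, Label.attr.injEq] at this
      rwa [this]
  have hne : v' ≠ w' := by
    rintro rfl
    exact hvw (Option.some.inj ((key hvc hvl).symm.trans (key hwc hwl)))
  have hm : meet p (t ++ [Label.attr a]) = meet p t := by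
    refine List.IsPrefix.eq_of_length_le (prefix_meet_iff.2 ⟨meet_prefix_left _ _, ?_⟩)
      (prefix_meet_iff.2 ⟨meet_prefix_left _ _,
        (meet_prefix_right _ _).trans (List.prefix_append _ _)⟩).length_le
    rcases List.prefix_concat_iff.1 (meet_prefix_right p (t ++ [Label.attr a])) with e | e
    · have := hP.isElem_of_prefix hp hpE (meet_prefix_left p (t ++ [Label.attr a]))
      rw [e, last_concat] at this
      simp [Label.isElem] at this
    · exact e
  have hv'E : (T.lab v').isElem = true := by rwa [lab_of_mem_N hT hv']
  rw [hm] at hu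
  exact h v' hv' w' hw' hne (not_agree_of_isElem hv'E hne) u hu
    (above_of_prefix hT hu hv' hb (.single hvc) (meet_prefix_right _ _))
    (above_of_prefix hT hu hw' hb' (.single hwc) (meet_prefix_right _ _))

/-- Let `v`, `w` over `s` violate `p → s` with common ancestor `u`. By `r → s` their ancestors `x`,
`y` over `r ∩ s` differ, so `u` lies above both. If `k` is an element path, `x` and `y` violate `p →
r ∩ s`, which follows from `p → k`. Otherwise `k = r`, unless `k = s`, and nodes over `r` below `x`
and `y` violate `p → r`. -/
theorem Sat.rule (hP : IsPathSet P) (hT : T.IsExtended) (hc : T.IsComplete P)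
    (hpE : p.last.isElem = true) {r s k : XPath E A} (hr : r ∈ P) (hs : s ∈ P)
    (hrs : T.Sat r s) (hpk : T.Sat p k) (hk : meet r s <+: k) (hk' : k <+: r ∨ k <+: s) :
    T.Sat p s := by
  have hkP : k ∈ P := hk'.elim (hP.prefix_mem _ hr _) (hP.prefix_mem _ hs _)
  by_cases hks : k = s
  · exact hks ▸ hpk
  by_cases hrs' : r = s
  · subst hrs'
    rw [meet_self] at hk
    exact absurd ((hk'.elim id id).eq_of_length_le hk.length_le) hks
  have hkr : ¬ k.last.isElem = true → k = r := fun h => hk'.elim (hP.eq_of_prefix hr h)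
    fun h' => absurd (hP.eq_of_prefix hs h h') hks
  -- distinct nodes over `s` that do not agree have different ancestors over `r ∩ s`,
  -- and the nodes over `r` below these do not agree either
  have key : ∀ v ∈ T.N s, ∀ w ∈ T.N s, v ≠ w → ¬ T.Agree v w →
      ∀ x ∈ T.N (meet r s), ∀ y ∈ T.N (meet r s), T.Below x v → T.Below y w →
      x ≠ y ∧ (¬ r.last.isElem = true → ∀ v' ∈ T.N r, ∀ w' ∈ T.N r, T.Below x v' → T.Below y w' →
        v' ≠ w' ∧ ¬ T.Agree v' w') := by
    intro v hv w hw hvw ha x hx y hy hb hb'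
    by_cases hrE : r.last.isElem = true
    · refine ⟨?_, fun h => absurd hrE h⟩
      rintro rfl
      exact (sat_iff_of_isElem hT hrE).1 hrs v hv w hw hvw ha x hx hb hb'
    · obtain ⟨-, -, h⟩ := (sat_iff_of_not_isElem hT hrE hrs').1 hrs v hv w hw hvw ha x hx y hy hb hb'
      refine ⟨?_, fun _ v' hv' w' hw' h1 h2 => ⟨?_, fun ha' => h v' hv' w' hw' h1 h2 ha'.2.2⟩⟩
      -- If `x = y`, the value of any node over `r` below it lies in both value sets.
      · rintro rfl
        obtain ⟨v', hv', h1⟩ := exists_below hT hc hr hx (meet_prefix_left r s)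
        exact h v' hv' v' hv' h1 h1 rfl
      · rintro rfl
        exact h v' hv' v' hv' h1 h2 rfl
  rw [sat_iff_of_isElem hT hpE]
  intro v hv w hw hvw ha u hu hb hb'
  obtain ⟨x, hx, hxv⟩ := exists_above hv (meet_prefix_right r s)
  obtain ⟨y, hy, hyw⟩ := exists_above hw (meet_prefix_right r s)
  obtain ⟨hxy, hrn⟩ := key v hv w hw hvw ha x hx y hy hxv hyw
  -- the common ancestor is above both nodes over `r ∩ s`
  have hps : meet p s <+: meet r s := by
    rcases List.prefix_or_prefix_of_prefix (meet_prefix_right p s) (meet_prefix_right r s) with h | h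
    · exact h
    · obtain ⟨z, hz, hzu⟩ := exists_above hu h
      exact absurd ((above_unique hT hx hz hxv (hzu.trans hb)).trans
        (above_unique hT hy hz hyw (hzu.trans hb')).symm) hxy
  have hux := above_of_prefix hT hu hx hb hxv hps
  have huy := above_of_prefix hT hu hy hb' hyw hps
  by_cases hkE : k.last.isElem = true
  · have h := Sat.prefix hT hc hpE hkP hkE hpk hk
    rw [sat_iff_of_isElem hT hpE] at h
    have e : meet p (meet r s) = meet p s :=
      List.IsPrefix.eq_of_length_le
        (prefix_meet_iff.2 ⟨meet_prefix_left _ _, (meet_prefix_right _ _).trans (meet_prefix_right _ _)⟩)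
        (prefix_meet_iff.2 ⟨meet_prefix_left _ _, hps⟩).length_le
    have hxE : (T.lab x).isElem = true := by
      rw [lab_of_mem_N hT hx]
      exact hP.isElem_of_prefix hkP hkE hk
    exact h x hx y hy hxy (not_agree_of_isElem hxE hxy) u (e ▸ hu) hux huy
  · obtain rfl := hkr hkE
    obtain ⟨v', hv', h1⟩ := exists_below hT hc hr hx (meet_prefix_left k s)
    obtain ⟨w', hw', h2⟩ := exists_below hT hc hr hy (meet_prefix_left k s)
    obtain ⟨hne, hna⟩ := hrn hkE v' hv' w' hw' h1 h2
    rw [sat_iff_of_isElem hT hpE] at hpk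
    -- the common ancestor `u` lies above the node over `p ∩ r`, which is not below `r ∩ s`
    have h3 : meet p s <+: meet p k :=
      prefix_meet_iff.2 ⟨meet_prefix_left _ _, hps.trans (meet_prefix_left _ _)⟩
    rcases List.prefix_or_prefix_of_prefix (meet_prefix_right p k) (meet_prefix_left k s) with h | h
    · have e : meet p k = meet p s := (prefix_meet_iff.2 ⟨meet_prefix_left _ _,
        h.trans (meet_prefix_right _ _)⟩).eq_of_length_le h3.length_le
      exact hpk v' hv' w' hw' hne hna u (e ▸ hu) (hux.trans h1) (huy.trans h2)
    · have e : meet k s = meet p s := (prefix_meet_iff.2 ⟨h.trans (meet_prefix_left _ _),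
        meet_prefix_right _ _⟩).eq_of_length_le hps.length_le
      rw [e] at hx hy
      exact hxy (((Below.eq hT hu hx hux).symm).trans (Below.eq hT hu hy huy))

end XTree

theorem Implies.prefix (hpE : p.last.isElem = true) {k t : XPath E A} (hk : k ∈ P)
    (hkE : k.last.isElem = true) (h : Implies P S p k) (ht : t <+: k) : Implies P S p t :=
  fun T T' hT hTP hm hS => (h T T' hT hTP hm hS).prefix hm.extended hm.complete hpE hk hkE ht

theorem Implies.att (hP : IsPathSet P) (hp : p ∈ P) (hpE : p.last.isElem = true)
    {k : XPath E A} (hk : k ∈ P) (hkA : k.last.isAttr = true) (h : Implies P S p k.parnt) :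
    Implies P S p k :=
  fun T T' hT hTP hm hS => (h T T' hT hTP hm hS).att hP hm.extended hp hpE hk hkA

theorem Implies.rule (hP : IsPathSet P) (hSP : ∀ f ∈ S, f.1 ∈ P ∧ f.2 ∈ P)
    (hpE : p.last.isElem = true) {f : XFD E A} (hf : f ∈ S) {k : XPath E A}
    (h : Implies P S p k) (hk : meet f.1 f.2 <+: k) (hk' : k <+: f.1 ∨ k <+: f.2) :
    Implies P S p f.2 :=
  fun T T' hT hTP hm hS => XTree.Sat.rule hP hm.extended hm.complete hpE (hSP f hf).1 (hSP f hf).2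
    (hS f hf) (h T T' hT hTP hm hS) hk hk'

end Soundness

/-! ### The counterexample built from a closed set of paths -/

section Countermodel

open XPath XTree

/-- `C` contains `p` and `root` and is closed under the rules of the closure algorithm. -/
structure IsClosure {E A : Type*} [DecidableEq E] [DecidableEq A] (P : Finset (XPath E A))
    (S : Finset (XFD E A)) (p : XPath E A) (C : Finset (XPath E A)) : Prop where
  subset : C ⊆ P
  mem_self : p ∈ C
  mem_nil : [] ∈ C
  mem_parnt : ∀ k ∈ C, k.last.isElem = true → k.parnt ∈ C
  mem_att : ∀ k ∈ P, k.last.isAttr = true → k.parnt ∈ C → k ∈ C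
  mem_rule : ∀ f ∈ S, ∀ k ∈ C, meet f.1 f.2 <+: k → (k <+: f.1 ∨ k <+: f.2) → f.2 ∈ C

variable {E A : Type*} [DecidableEq E] [DecidableEq A] {P C : Finset (XPath E A)}
  {S : Finset (XFD E A)} {p : XPath E A}

theorem IsClosure.mem_prefix (hP : IsPathSet P) (hC : IsClosure P S p C) {k t : XPath E A}
    (hk : k ∈ C) (hkE : k.last.isElem = true) (ht : t <+: k) : t ∈ C := by
  induction k using List.reverseRecOn with
  | nil => rw [List.prefix_nil] at ht; rwa [ht]
  | append_singleton k l ih =>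
    rcases List.prefix_concat_iff.1 ht with rfl | ht
    · exact hk
    · exact ih (by simpa using hC.mem_parnt _ hk hkE)
        (hP.isElem_of_prefix (hC.subset hk) hkE (List.prefix_append _ _)) ht

/-- The path `k` has two nodes in the counterexample for `C`. -/
def IsDouble (C : Finset (XPath E A)) (k : XPath E A) : Bool := decide (k ∉ C ∨ k.parnt ∉ C)

/-- Doubling is inherited downwards, so each copy of a node has its own copies below it. This needs
the second alternative in `IsDouble`: an attribute or text path may lie in `C` without its parent.
-/
theorem IsClosure.isDouble_mono (hP : IsPathSet P) (hC : IsClosure P S p C) {k t : XPath E A}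
    (hk : k ∈ P) (ht : t <+: k) (h : IsDouble C t = true) : IsDouble C k = true := by
  by_cases e : t = k
  · rwa [← e]
  have htE := hP.inner_elem k hk t ht e
  simp only [IsDouble, decide_eq_true_eq] at h ⊢
  have htC : t ∉ C := h.elim id fun h htC => h (hC.mem_parnt t htC htE)
  exact .inr fun hkC => htC (hC.mem_prefix hP hkC (hP.isElem_parnt hk) (prefix_parnt ht e))

/-- The nodes of the counterexample: one or two for each path in `P`. -/
def CNode (P C : Finset (XPath E A)) : Type :=
  {x : Fin P.card × Bool // x.2 = true → IsDouble C (P.equivFin.symm x.1).1 = true}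

namespace CNode

noncomputable instance : Fintype (CNode P C) := by unfold CNode; infer_instance

/-- Nodes store an index instead of the path because `XTree.V` lives in `Type`, whereas labels may
live in any universe. -/
noncomputable def path (v : CNode P C) : XPath E A := (P.equivFin.symm v.1.1).1

def bit (v : CNode P C) : Bool := v.1.2

/-- Over a path with a single node the bit is reset to `false`, so any bit may be passed. -/
noncomputable def mk (k : XPath E A) (hk : k ∈ P) (b : Bool) : CNode P C :=
  ⟨(P.equivFin ⟨k, hk⟩, b && IsDouble C k), by simp⟩

theorem path_mem (v : CNode P C) : v.path ∈ P := (P.equivFin.symm v.1.1).2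

@[simp] theorem path_mk {k : XPath E A} (hk : k ∈ P) (b : Bool) :
    (mk k hk b : CNode P C).path = k := by simp [path, mk]

@[simp] theorem bit_mk {k : XPath E A} (hk : k ∈ P) (b : Bool) :
    (mk k hk b : CNode P C).bit = (b && IsDouble C k) := rfl

theorem bit_and (v : CNode P C) : (v.bit && IsDouble C v.path) = v.bit := by
  have := v.2
  unfold bit path
  cases h : v.1.2 <;> simp_all

theorem ext' {v w : CNode P C} (h : v.path = w.path) (h' : v.bit = w.bit) : v = w :=
  Subtype.ext (Prod.ext (P.equivFin.symm.injective (Subtype.ext h)) h')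

/-- `v` is a child of `u`. -/
def IsChild (u v : CNode P C) : Prop :=
  v.path ≠ [] ∧ u.path = v.path.parnt ∧ u.bit = (v.bit && IsDouble C u.path)

end CNode

open CNode

open Classical in
/-- The counterexample. -/
noncomputable abbrev counterTree (P C : Finset (XPath E A)) (h : [] ∈ P) : XTree E A where
  V := CNode P C
  null := ∅
  lab v := v.path.last
  ele u := if u.path.last.isElem = true then
    some (Finset.univ.filter fun v => IsChild u v ∧ ¬ v.path.last.isAttr = true).toList else none
  att u a := if h : ∃ v, IsChild u v ∧ v.path.last = Label.attr a then some h.choose else none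
  -- Two copies over a path in `C` have the same string, two copies over another path have different
  -- ones.
  str v := if v.path ∈ C then String.ofList [] else String.ofList (if v.bit then [] else [default])
  vr := CNode.mk [] h false

theorem counterTree_child (hP : IsPathSet P) (h : [] ∈ P) (hC : IsClosure P S p C)
    {u v : CNode P C} : (counterTree P C h).Child u v ↔ IsChild u v := by
  constructor
  · rintro (⟨l, hl, hv⟩ | ⟨a, ha⟩)
    · dsimp only [counterTree] at hl
      split_ifs at hl
      simp only [Option.some.injEq] at hl
      subst hl
      simp only [Finset.mem_toList, Finset.mem_filter, Finset.mem_univ, true_and] at hv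
      exact hv.1
    · dsimp only [counterTree] at ha
      split_ifs at ha with hex
      simp only [Option.some.injEq] at ha
      exact ha ▸ hex.choose_spec.1
  · intro hc
    by_cases hv : v.path.last.isAttr = true
    · obtain ⟨a, ha⟩ : ∃ a, v.path.last = Label.attr a := by
        cases e : v.path.last <;> simp_all [Label.isAttr]
      refine .inr ⟨a, ?_⟩
      have hex : ∃ v, IsChild u v ∧ v.path.last = Label.attr a := ⟨v, hc, ha⟩
      dsimp only [counterTree]
      rw [dif_pos hex, Option.some.injEq]
      obtain ⟨hc', ha'⟩ := hex.choose_spec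
      generalize hex.choose = w at hc' ha'
      have e : w.path = v.path := by
        rw [← parnt_append_last hc'.1, ← parnt_append_last hc.1, ← hc'.2.1, hc.2.1, ha', ha]
      refine ext' e ?_
      -- Uniqueness of the attribute child: below a doubled path the bit is that of the parent;
      -- below a single one the attribute path is in `C` by `mem_att`, hence single.
      by_cases hd : IsDouble C u.path = true
      · have h1 := hc.2.2
        have h2 := hc'.2.2
        rw [hd, Bool.and_true] at h1 h2
        rw [← h1, ← h2]
      · have hd' : IsDouble C v.path = false := by
          simp only [IsDouble, decide_eq_true_eq, not_or, not_not, hc.2.1] at hd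
          simp only [IsDouble, decide_eq_false_iff_not, not_or, not_not]
          exact ⟨hC.mem_att _ v.path_mem hv hd.1, hd.1⟩
        rw [← w.bit_and, ← v.bit_and, e, hd', Bool.and_false, Bool.and_false]
    · refine .inl ⟨_, if_pos ?_, ?_⟩
      · rw [hc.2.1]; exact hP.isElem_parnt v.path_mem
      · simp [hc, hv]

theorem counterTree_isExtended (hP : IsPathSet P) (h : [] ∈ P) (hC : IsClosure P S p C) :
    (counterTree P C h).IsExtended := by
  have hch := fun u v => counterTree_child (u := u) (v := v) hP h hC
  refine ⟨?_, ?_, ?_, ?_, ?_, ?_, ?_, ?_, ?_, ?_, ?_⟩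
  · exact inferInstanceAs (Finite (CNode P C))
  · simp [last]
  · exact id
  · intro v l hl
    dsimp only [counterTree] at hl ⊢
    split_ifs at hl with h
    exact h
  · intro v l hl
    dsimp only [counterTree] at hl
    split_ifs at hl with h
    simp only [Option.some.injEq] at hl
    subst hl
    exact Finset.nodup_toList _
  · intro v l hl w hw
    dsimp only [counterTree] at hl
    split_ifs at hl with h
    simp only [Option.some.injEq] at hl
    subst hl
    simp only [Finset.mem_toList, Finset.mem_filter, Finset.mem_univ, true_and] at hw
    have := hw.2
    dsimp only [counterTree]
    cases e : w.path.last <;> simp_all [Label.isElem, Label.isAttr]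
  · intro v a w hw
    have hc := (hch v w).1 (.inr ⟨a, hw⟩)
    dsimp only [counterTree]
    rw [hc.2.1]
    exact hP.isElem_parnt w.path_mem
  · intro v a w hw
    dsimp only [counterTree] at hw ⊢
    split_ifs at hw with hex
    simp only [Option.some.injEq] at hw
    exact hw ▸ hex.choose_spec.2
  · intro u hu
    exact ((hch _ _).1 hu).1 (path_mk _ _)
  · intro u u' v hu hu'
    have h1 := (hch _ _).1 hu
    have h2 := (hch _ _).1 hu'
    have e := h1.2.1.trans h2.2.1.symm
    exact ext' e (by rw [h1.2.2, h2.2.2, e])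
  · intro v
    generalize hk : CNode.path v = k
    induction k using List.reverseRecOn generalizing v with
    | nil =>
      have : v = (counterTree P C h).vr := ext' (by rw [hk]; simp) (by
        rw [← bit_and, hk]
        simp [IsDouble, hC.mem_nil, parnt])
      rw [this]
    | append_singleton k l ih =>
      have hkP : k ∈ P := hP.prefix_mem _ (path_mem v) _ (hk ▸ List.prefix_append _ _)
      refine (ih (CNode.mk k hkP v.bit) (path_mk _ _)).tail ((hch _ _).2 ⟨by simp [hk], ?_, ?_⟩)
      · simp [hk]
      · simp

theorem counterTree_mem_N (hP : IsPathSet P) (h : [] ∈ P) (hC : IsClosure P S p C) {k : XPath E A}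
    {v : CNode P C} : v ∈ (counterTree P C h).N k ↔ v.path = k := by
  have hT := counterTree_isExtended hP h hC
  induction k using List.reverseRecOn generalizing v with
  | nil =>
    rw [mem_N_nil hT]
    constructor
    · rintro rfl; simp
    · intro hk
      exact ext' (by rw [hk]; simp) (by
        rw [← bit_and, hk]
        simp [IsDouble, hC.mem_nil, parnt])
  | append_singleton k l ih =>
    rw [mem_N_concat]
    constructor
    · rintro ⟨u, hu, hc, hl⟩
      have hc := (counterTree_child hP h hC).1 hc
      have hu := ih.1 hu
      rw [← parnt_append_last hc.1, ← hc.2.1, hu]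
      exact congrArg (k ++ [·]) hl
    · intro hk
      have hkP : k ∈ P := hP.prefix_mem _ v.path_mem _ (hk ▸ List.prefix_append _ _)
      refine ⟨CNode.mk k hkP v.bit, ih.2 (path_mk _ _),
        (counterTree_child hP h hC).2 ⟨by simp [hk], ?_, ?_⟩, ?_⟩
      · simp [hk]
      · simp
      · simp [hk]

/-- Going up keeps the bit until a single node is reached, and from there on all nodes are single.
-/
theorem counterTree_below (hP : IsPathSet P) (h : [] ∈ P) (hC : IsClosure P S p C)
    {u v : CNode P C} : (counterTree P C h).Below u v ↔
      u.path <+: v.path ∧ u.bit = (v.bit && IsDouble C u.path) := by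
  constructor
  · intro hb
    induction hb with
    | refl => exact ⟨List.prefix_rfl, (bit_and u).symm⟩
    | @tail w v _ hc ih =>
      have hc := (counterTree_child hP h hC).1 hc
      refine ⟨ih.1.trans (hc.2.1 ▸ parnt_prefix _), ?_⟩
      rw [ih.2, hc.2.2]
      cases hd : IsDouble C (CNode.path u)
      · simp
      · rw [hC.isDouble_mono hP (path_mem w) ih.1 hd, Bool.and_true]
  · rintro ⟨h1, h2⟩
    generalize hk : CNode.path v = k at h1
    induction k using List.reverseRecOn generalizing v with
    | nil =>
      rw [List.prefix_nil] at h1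
      have : u = v := ext' (h1.trans hk.symm) (by rw [h2, h1, ← hk, bit_and])
      exact this ▸ .refl
    | append_singleton k l ih =>
      rcases List.prefix_concat_iff.1 h1 with h1 | h1
      · have : u = v := ext' (h1.trans hk.symm) (by rw [h2, h1, ← hk, bit_and])
        exact this ▸ .refl
      · have hkP : k ∈ P := hP.prefix_mem _ v.path_mem _ (hk ▸ List.prefix_append _ _)
        refine (@ih (CNode.mk k hkP v.bit) ?_ (path_mk _ _) h1).tail
          ((counterTree_child hP h hC).2 ⟨by simp [hk], by simp [hk], by simp⟩)
        rw [h2, bit_mk]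
        cases hd : IsDouble C (CNode.path u)
        · simp only [Bool.and_false]
        · rw [hC.isDouble_mono hP hkP h1 hd]; simp

theorem counterTree_isMinimalExtension (hP : IsPathSet P) (hc : LabelConsistent P) (h : [] ∈ P)
    (hC : IsClosure P S p C) :
    IsMinimalExtension P (counterTree P C h) (counterTree P C h) := by
  have hT := counterTree_isExtended hP h hC
  refine ⟨hT, ⟨id, Function.injective_id, ?_, rfl, fun _ => rfl, fun _ => rfl, ?_⟩, ?_, ?_, ?_, ?_⟩
  · rw [Set.range_id]; exact Set.compl_empty.symm
  · intro u v huv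
    exact ⟨[], by simp, by simpa using huv⟩
  · intro v k hk hl
    obtain ⟨t, ht, e⟩ := mem_labels_iff.1 hl
    -- Label consistency makes the path of `v` a prefix of `k`; the node over `k` with the same bit
    -- is then below `v`.
    obtain rfl := hc k hk (CNode.path v) (path_mem v) t ht e
    obtain ⟨vs, h1, h2⟩ := (counterTree_mem_N hP h hC).2 (path_mk (C := C) hk (CNode.bit v))
    exact ⟨vs, h1, (mem_instance_iff hT h1 h2).2 ((counterTree_below hP h hC).2
      ⟨by rwa [path_mk], by
        rw [bit_mk]
        cases hd : IsDouble C (CNode.path v)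
        · rw [← bit_and, hd]; simp
        · rw [hC.isDouble_mono hP hk ht hd]; simp⟩)⟩
  · intro v
    obtain ⟨vs, h1, h2⟩ := (counterTree_mem_N hP h hC).2 (rfl : CNode.path v = _)
    exact ⟨_, path_mem v, vs, h1, (mem_instance_iff hT h1 h2).2 .refl⟩
  · rintro n ⟨⟩
  · exact fun n hn => absurd ⟨n, id, .refl⟩ hn

theorem counterTree_consistent (hP : IsPathSet P) (hc : LabelConsistent P) (h : [] ∈ P)
    (hC : IsClosure P S p C) : (counterTree P C h).Consistent P := by
  refine ⟨hc, fun u v huv => ?_⟩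
  have huv := (counterTree_child hP h hC).1 huv
  refine ⟨_, path_mem v, _, _, parnt_prefix (CNode.path v), ?_, List.prefix_rfl, ?_, rfl⟩
  · intro e
    have := congrArg List.length (parnt_append_last huv.1)
    rw [e] at this
    simp at this
  · rw [← huv.2.1]

theorem CNode.bit_ne {v w : CNode P C} (hvw : v.path = w.path) (hne : v ≠ w) : v.bit ≠ w.bit :=
  fun h => hne (ext' hvw h)

theorem CNode.isDouble_of_ne {v w : CNode P C} (hvw : v.path = w.path) (hne : v ≠ w) :
    IsDouble C v.path = true := by
  by_contra h
  refine bit_ne hvw hne ?_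
  rw [← v.bit_and, ← w.bit_and, ← hvw, Bool.eq_false_iff.2 h, Bool.and_false, Bool.and_false]

theorem counterTree_val_ne (h : [] ∈ P) {v w : CNode P C}
    (hvw : v.path = w.path) (hne : v ≠ w) (hd : v.path ∉ C) :
    (counterTree P C h).val v ≠ (counterTree P C h).val w := by
  intro e
  have hb := bit_ne hvw hne
  have hd' : w.path ∉ C := hvw ▸ hd
  unfold val at e
  by_cases hE : v.path.last.isElem = true
  · have hE' : w.path.last.isElem = true := hvw ▸ hE
    rw [if_pos (.inl hE), if_pos (.inl hE')] at e
    exact hne (Sum.inl.inj e)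
  · have hE' : ¬ w.path.last.isElem = true := hvw ▸ hE
    rw [if_neg (by simpa using hE), if_neg (by simpa using hE')] at e
    have e := Sum.inr.inj e
    dsimp only [counterTree] at e
    rw [if_neg hd, if_neg hd', String.ofList_inj] at e
    cases hv : v.bit <;> cases hw : w.bit <;> simp_all

theorem counterTree_agree (h : [] ∈ P) {v w : CNode P C}
    (hvw : v.path = w.path) (hd : v.path ∈ C) (hE : ¬ v.path.last.isElem = true) :
    (counterTree P C h).Agree v w := by
  have hE' : ¬ w.path.last.isElem = true := hvw ▸ hE
  have hd' : w.path ∈ C := hvw ▸ hd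
  refine ⟨id, id, ?_⟩
  unfold val
  rw [if_neg (by simpa using hE), if_neg (by simpa using hE')]
  dsimp only [counterTree]
  rw [if_pos hd, if_pos hd']

theorem counterTree_sat (hP : IsPathSet P) (h : [] ∈ P) (hC : IsClosure P S p C)
    (hSP : ∀ f ∈ S, f.1 ∈ P ∧ f.2 ∈ P) {f : XFD E A} (hf : f ∈ S) :
    (counterTree P C h).Sat f.1 f.2 := by
  have hT := counterTree_isExtended hP h hC
  obtain ⟨r, s⟩ := f
  obtain ⟨hr, hs⟩ := hSP _ hf
  have hrule := hC.mem_rule _ hf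
  dsimp only at hr hs hrule ⊢
  by_cases hrs : r = s
  · exact .inl hrs
  -- two nodes over `s` that do not agree lie in different copies
  have key : ∀ v w : CNode P C, v.path = s → w.path = s → v ≠ w →
      ¬ (counterTree P C h).Agree v w → s ∉ C := by
    intro v w hv hw hvw ha hsC
    have hvw' := hv.trans hw.symm
    -- For `s ∈ C`, nodes that are not element nodes share their string, and element nodes are not
    -- doubled.
    refine ha (counterTree_agree h hvw' (hv ▸ hsC) fun hE => ?_)
    have := isDouble_of_ne hvw' hvw
    rw [hv] at this hE
    simp only [IsDouble, decide_eq_true_eq] at this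
    exact this.elim (· hsC) (· (hC.mem_parnt s hsC hE))
  -- The closure rule with `k = r ∩ s` gives `r ∩ s ∉ C`, so this path is doubled and bits survive
  -- up to it.
  have copy : ∀ x v : CNode P C, s ∉ C → x.path = meet r s → (counterTree P C h).Below x v →
      x.bit = v.bit := by
    intro x v hsC hx hb
    have hm : meet r s ∉ C := fun hm => hsC (hrule _ hm List.prefix_rfl (.inl (meet_prefix_left _ _)))
    rw [((counterTree_below hP h hC).1 hb).2, hx]
    simp [IsDouble, hm]
  by_cases hrE : r.last.isElem = true
  · rw [sat_iff_of_isElem hT hrE]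
    intro v hv w hw hvw ha u hu hb hb'
    rw [counterTree_mem_N hP h hC] at hv hw hu
    have hsC := key v w hv hw hvw ha
    exact bit_ne (hv.trans hw.symm) hvw ((copy u v hsC hu hb).symm.trans (copy u w hsC hu hb'))
  · rw [sat_iff_of_not_isElem hT hrE hrs]
    intro v hv w hw hvw ha x hx y hy hb hb'
    refine ⟨fun _ _ _ => id, fun _ _ _ => id, fun v' hv' w' hw' h1 h2 => ?_⟩
    rw [counterTree_mem_N hP h hC] at hv hw hx hy hv' hw'
    have hsC := key v w hv hw hvw ha
    refine counterTree_val_ne h (hv'.trans hw'.symm) ?_ fun hrC => ?_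
    · rintro rfl
      refine bit_ne (hv.trans hw.symm) hvw ?_
      rw [← copy x v hsC hx hb, ← copy y w hsC hy hb', copy x v' hsC hx h1, copy y v' hsC hy h2]
    -- The closure rule with `k = r` excludes `r ∈ C`.
    · rw [hv'] at hrC
      exact hsC (hrule _ hrC (meet_prefix_left _ _) (.inl List.prefix_rfl))

/-- As a prefix of the element path `p`, `p ∩ q` is in `C` with its parent, so its single node is
above both copies of `q`. -/
theorem counterTree_not_sat (hP : IsPathSet P) (h : [] ∈ P) (hC : IsClosure P S p C)
    (hpE : p.last.isElem = true) {q : XPath E A} (hq : q ∈ P) (hqC : q ∉ C) :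
    ¬ (counterTree P C h).Sat p q := by
  rw [sat_iff_of_isElem (counterTree_isExtended hP h hC) hpE]
  intro hsat
  have hm : meet p q ∈ C := hC.mem_prefix hP hC.mem_self hpE (meet_prefix_left p q)
  have hmE := hP.isElem_of_prefix (hC.subset hC.mem_self) hpE (meet_prefix_left p q)
  have hm' : IsDouble C (meet p q) = false := by
    simp [IsDouble, hm, hC.mem_parnt _ hm hmE]
  have hne : CNode.mk (C := C) q hq false ≠ CNode.mk q hq true := by
    intro e
    have := congrArg bit e
    simp [IsDouble, hqC] at this
  refine hsat _ ((counterTree_mem_N hP h hC).2 (path_mk hq false)) _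
    ((counterTree_mem_N hP h hC).2 (path_mk hq true)) hne
    (fun ha => counterTree_val_ne h (by simp) hne (by simpa using hqC) ha.2.2)
    (CNode.mk (meet p q) (hC.subset hm) false)
    ((counterTree_mem_N hP h hC).2 (path_mk _ _)) ?_ ?_ <;>
  · rw [counterTree_below hP h hC]
    simp [hm', meet_prefix_right]

theorem IsClosure.mem_of_implies (hP : IsPathSet P) (hc : LabelConsistent P)
    (hSP : ∀ f ∈ S, f.1 ∈ P ∧ f.2 ∈ P) (hpE : p.last.isElem = true) (hC : IsClosure P S p C)
    {q : XPath E A} (hq : q ∈ P) (h : Implies P S p q) : q ∈ C := by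
  by_contra hqC
  have h0 := hC.subset hC.mem_nil
  exact counterTree_not_sat hP h0 hC hpE hq hqC (h _ _ ⟨counterTree_isExtended hP h0 hC, rfl⟩
    (counterTree_consistent hP hc h0 hC) (counterTree_isMinimalExtension hP hc h0 hC)
    fun f hf => counterTree_sat hP h0 hC hSP hf)

end Countermodel

/-! ### Termination and correctness of arbitrary runs -/

section Algorithm

open XPath Closure

variable {E A : Type*} [DecidableEq E] [DecidableEq A] {P C : Finset (XPath E A)}
  {S : Finset (XFD E A)} {p : XPath E A}

theorem IsClosure.mem_iff (hP : IsPathSet P) (hc : LabelConsistent P)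
    (hSP : ∀ f ∈ S, f.1 ∈ P ∧ f.2 ∈ P) (hpE : p.last.isElem = true) (hC : IsClosure P S p C)
    (hs : ∀ k ∈ C, Implies P S p k) (q : XPath E A) : q ∈ C ↔ q ∈ P ∧ Implies P S p q :=
  ⟨fun h => ⟨hC.subset h, hs q h⟩, fun h => hC.mem_of_implies hP hc hSP hpE h.1 h.2⟩

namespace Closure

/-! ### Runs of the closure algorithm -/

theorem Run.card {n : ℕ} {X Y : State E A} (h : Run P n X Y) :
    n + Y.unused.card = X.unused.card := by
  induction h with
  | refl => simp
  | tail _ hi ih =>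
    obtain ⟨f, hf, -, rfl⟩ := hi
    have := Finset.card_erase_add_one hf
    dsimp only
    omega

theorem subset_extend (P out : Finset (XPath E A)) (s : XPath E A) : out ⊆ extend P out s := by
  intro k hk
  unfold extend
  split_ifs <;> simp [hk]

theorem mem_extend_self (P out : Finset (XPath E A)) (s : XPath E A) : s ∈ extend P out s := by
  unfold extend
  split_ifs <;> simp

/-- What `extend` adds depends on `P` and `s` only. -/
theorem extend_idem {out out' : Finset (XPath E A)} {s : XPath E A} (h : extend P out s ⊆ out') :
    extend P out' s = out' := by
  refine (Finset.Subset.antisymm (subset_extend P out' s) ?_).symm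
  unfold extend at h ⊢
  split_ifs at h ⊢ <;> dsimp only at h ⊢ <;> simp only [Finset.union_subset_iff] at h ⊢ <;>
    simp [h]

/-- What is preserved by the iterations: the used XFDs are exhausted. -/
theorem Run.exhausted {n : ℕ} {X Y : State E A} (h : Run P n X Y) :
    ∀ f ∈ X.unused, f ∉ Y.unused → extend P Y.out f.2 = Y.out := by
  induction h with
  | refl => exact fun f h h' => absurd h h'
  | @tail n X Y Z _ hi ih =>
    obtain ⟨g, hg, -, rfl⟩ := hi
    intro f hf hf'
    simp only [Finset.mem_erase, not_and] at hf'
    by_cases e : f = g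
    · subst e
      exact extend_idem Finset.Subset.rfl
    · refine extend_idem (out := Y.out) ?_
      rw [ih f hf (hf' e)]
      exact subset_extend _ _ _

theorem exists_finished (S : Finset (XFD E A)) (X Y : State E A) (hX : X.unused = S) {n : ℕ}
    (h : Run P n X Y) : ∃ n Z, Run P n X Z ∧ Finished P S Z := by
  by_cases hf : Finished P S Y
  · exact ⟨n, Y, h, hf⟩
  · unfold Finished at hf
    push Not at hf
    obtain ⟨f, hfS, ha, hne⟩ := hf
    -- A used XFD no longer changes `P⁺`, so one that does is still available.
    have hfY : f ∈ Y.unused := by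
      by_contra hfY
      exact hne (h.exhausted f (hX ▸ hfS) hfY)
    exact exists_finished S X _ hX (h.tail ⟨f, hfY, ha, rfl⟩)
  termination_by Y.unused.card
  decreasing_by exact Finset.card_erase_lt_of_mem hfY

/-- A set of paths all of which depend on `p`. -/
def Sound (P : Finset (XPath E A)) (S : Finset (XFD E A)) (p : XPath E A)
    (C : Finset (XPath E A)) : Prop := ∀ k ∈ C, k ∈ P ∧ Implies P S p k

theorem Sound.biUnion_att (hP : IsPathSet P) (hp : p ∈ P) (hpE : p.last.isElem = true)
    (h : Sound P S p C) : Sound P S p (C ∪ C.biUnion (att P)) := by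
  intro k hk
  rcases Finset.mem_union.1 hk with hk | hk
  · exact h k hk
  · obtain ⟨t, ht, hk⟩ := Finset.mem_biUnion.1 hk
    obtain ⟨hkP, hkA, rfl⟩ := mem_att.1 hk
    exact ⟨hkP, (h _ ht).2.att hP hp hpE hkP hkA⟩

theorem Sound.start (hP : IsPathSet P) (hp : p ∈ P) (hpE : p.last.isElem = true) :
    Sound P S p (start P S p).out := by
  refine Sound.biUnion_att hP hp hpE fun k hk => ?_
  simp only [hpE, if_true, Finset.mem_union, Finset.mem_insert, Finset.mem_singleton, mem_anc] at hk
  rcases hk with (rfl | rfl) | ⟨-, hk⟩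
  · exact ⟨hp, implies_self⟩
  · exact ⟨hP.prefix_mem p hp _ List.nil_prefix, implies_nil hpE⟩
  · exact ⟨hP.prefix_mem p hp _ hk, implies_self.prefix hpE hp hpE hk⟩

theorem Sound.extend (hP : IsPathSet P) (hp : p ∈ P) (hpE : p.last.isElem = true)
    (h : Sound P S p C) {s : XPath E A} (hs : s ∈ P) (hs' : Implies P S p s) :
    Sound P S p (extend P C s) := by
  intro k hk
  unfold Closure.extend at hk
  split_ifs at hk with hsE
  · simp only [Finset.mem_union, Finset.mem_singleton, mem_anc, mem_att] at hk
    rcases hk with ((hk | rfl) | ⟨-, hk⟩) | ⟨hkP, hkA, rfl⟩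
    · exact h k hk
    · exact ⟨hs, hs'⟩
    · exact ⟨hP.prefix_mem s hs _ hk, hs'.prefix hpE hs hsE hk⟩
    · exact ⟨hkP, hs'.att hP hp hpE hkP hkA⟩
  · simp only [Finset.mem_union, Finset.mem_singleton] at hk
    rcases hk with hk | rfl
    · exact h k hk
    · exact ⟨hs, hs'⟩

theorem Sound.run (hP : IsPathSet P) (hSP : ∀ f ∈ S, f.1 ∈ P ∧ f.2 ∈ P) (hp : p ∈ P)
    (hpE : p.last.isElem = true) {n : ℕ} {X Y : State E A} (h : Run P n X Y) (hX : X.unused ⊆ S)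
    (hs : Sound P S p X.out) : Sound P S p Y.out ∧ Y.unused ⊆ S := by
  induction h with
  | refl => exact ⟨hs, hX⟩
  | @tail n X Y Z _ hi ih =>
    obtain ⟨ih, ihS⟩ := ih hX hs
    obtain ⟨f, hf, ha, rfl⟩ := hi
    have hfS := ihS hf
    refine ⟨ih.extend hP hp hpE (hSP f hfS).2 ?_, (Finset.erase_subset _ _).trans ihS⟩
    -- The last two tests are instances of the first, with `k = r` and with `k` the path root.
    rcases ha with ⟨k, hk, h1, h2⟩ | hr | h0
    · exact (ih k hk).2.rule hP hSP hpE hfS h1 h2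
    · exact (ih _ hr).2.rule hP hSP hpE hfS (meet_prefix_left _ _) (.inl List.prefix_rfl)
    · exact (implies_nil hpE).rule hP hSP hpE hfS (h0 ▸ List.prefix_rfl) (.inl List.nil_prefix)

/-- The element paths in `C` have their prefixes in `C`. -/
def PrefixClosed (C : Finset (XPath E A)) : Prop :=
  ∀ k ∈ C, k.last.isElem = true → ∀ t : XPath E A, t <+: k → t ∈ C

theorem prefixClosed_biUnion_att (h : PrefixClosed C) : PrefixClosed (C ∪ C.biUnion (att P)) := by
  intro k hk hkE t ht
  rcases Finset.mem_union.1 hk with hk | hk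
  · exact Finset.mem_union_left _ (h k hk hkE t ht)
  · obtain ⟨u, -, hk⟩ := Finset.mem_biUnion.1 hk
    exact absurd hkE (not_isElem_of_isAttr (mem_att.1 hk).2.1)

theorem prefixClosed_start (hpE : p.last.isElem = true) : PrefixClosed (start P S p).out := by
  refine prefixClosed_biUnion_att fun k hk hkE t ht => ?_
  simp only [hpE, if_true, Finset.mem_union, Finset.mem_insert, Finset.mem_singleton, mem_anc]
    at hk ⊢
  rcases hk with (rfl | rfl) | ⟨-, hk⟩
  · tauto
  · simp_all
  · have := ht.trans hk
    tauto

theorem PrefixClosed.extend (h : PrefixClosed C) (s : XPath E A) :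
    PrefixClosed (extend P C s) := by
  intro k hk hkE t ht
  unfold Closure.extend at hk ⊢
  split_ifs at hk ⊢ with hsE
  · simp only [Finset.mem_union, Finset.mem_singleton, mem_anc, mem_att] at hk ⊢
    rcases hk with ((hk | rfl) | ⟨-, hk⟩) | ⟨hkP, hkA, rfl⟩
    · exact .inl (.inl (.inl (h k hk hkE t ht)))
    · tauto
    · have := ht.trans hk
      tauto
    · exact absurd hkE (not_isElem_of_isAttr hkA)
  · simp only [Finset.mem_union, Finset.mem_singleton] at hk ⊢
    rcases hk with hk | rfl
    · exact .inl (h k hk hkE t ht)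
    · exact absurd hkE hsE

theorem PrefixClosed.run {n : ℕ} {X Y : State E A} (h : Run P n X Y) (hX : PrefixClosed X.out) :
    PrefixClosed Y.out := by
  induction h with
  | refl => exact hX
  | tail _ hi ih =>
    obtain ⟨f, -, -, rfl⟩ := hi
    exact (ih hX).extend _

theorem Run.subset {n : ℕ} {X Y : State E A} (h : Run P n X Y) : X.out ⊆ Y.out := by
  induction h with
  | refl => exact Finset.Subset.rfl
  | tail _ hi ih =>
    obtain ⟨f, -, -, rfl⟩ := hi
    exact ih.trans (subset_extend _ _ _)

/-- The attributes added after the loop enable nothing new: if such a `k` triggers `r → s` and `k ≠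
s`, then `k = r`, and the parent of `k`, already in `P⁺`, triggers it too. -/
theorem isClosure_output (hP : IsPathSet P) (hSP : ∀ f ∈ S, f.1 ∈ P ∧ f.2 ∈ P) (hp : p ∈ P)
    (hpE : p.last.isElem = true) {n : ℕ} {X : State E A} (h : Run P n (start P S p) X)
    (hf : Finished P S X) : IsClosure P S p (output P X) := by
  have hpc : PrefixClosed X.out := (prefixClosed_start hpE).run h
  have hsub : X.out ⊆ output P X := Finset.subset_union_left
  have hstart : ({p, []} : Finset (XPath E A)) ⊆ X.out := by
    refine Finset.Subset.trans ?_ h.subset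
    simp only [start, hpE, if_true]
    exact Finset.subset_union_left.trans Finset.subset_union_left
  have hatt : ∀ k ∈ output P X, k ∈ X.out ∨ k.last.isAttr = true ∧ k.parnt ∈ X.out := by
    intro k hk
    rcases Finset.mem_union.1 hk with hk | hk
    · exact .inl hk
    · obtain ⟨t, ht, hk⟩ := Finset.mem_biUnion.1 hk
      obtain ⟨-, hkA, rfl⟩ := mem_att.1 hk
      exact .inr ⟨hkA, ht⟩
  refine ⟨fun k hk => ?_, hsub (hstart (by simp)), hsub (hstart (by simp)), ?_, ?_, ?_⟩
  · exact (((Sound.start hP hp hpE).run hP hSP hp hpE h Finset.Subset.rfl).1.biUnion_att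
      hP hp hpE k hk).1
  · intro k hk hkE
    rcases hatt k hk with hk | ⟨hkA, -⟩
    · exact hsub (hpc k hk hkE _ (parnt_prefix k))
    · exact absurd hkE (not_isElem_of_isAttr hkA)
  · intro k hkP hkA hk
    rcases hatt _ hk with hk | ⟨hkA', -⟩
    · exact Finset.mem_union_right _ (Finset.mem_biUnion.2 ⟨_, hk, mem_att.2 ⟨hkP, hkA, rfl⟩⟩)
    · exact absurd (hP.isElem_parnt hkP) (not_isElem_of_isAttr hkA')
  · intro f hfS k hk h1 h2
    by_cases hks : k = f.2
    · exact hks ▸ hk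
    have happ : ∀ k ∈ X.out, meet f.1 f.2 <+: k → (k <+: f.1 ∨ k <+: f.2) → f.2 ∈ output P X := by
      intro k hk h1 h2
      refine hsub ?_
      rw [← hf f hfS (.inl ⟨k, hk, h1, h2⟩)]
      exact mem_extend_self _ _ _
    rcases hatt k hk with hk' | ⟨hkA, hk'⟩
    · exact happ k hk' h1 h2
    · have hkE := not_isElem_of_isAttr hkA
      have hkr : k = f.1 := h2.elim (hP.eq_of_prefix (hSP f hfS).1 hkE)
        fun h => absurd (hP.eq_of_prefix (hSP f hfS).2 hkE h) hks
      refine happ _ hk' (prefix_parnt h1 fun e => hks ?_) (.inl ?_)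
      · exact hP.eq_of_prefix (hSP f hfS).2 hkE (e ▸ meet_prefix_right _ _)
      · exact (parnt_prefix k).trans (hkr ▸ List.prefix_rfl)

theorem output_iff (hP : IsPathSet P) (hc : LabelConsistent P)
    (hSP : ∀ f ∈ S, f.1 ∈ P ∧ f.2 ∈ P) (hp : p ∈ P)
    (hpE : p.last.isElem = true) {n : ℕ} {X : State E A} (h : Run P n (start P S p) X)
    (hf : Finished P S X) (q : XPath E A) : q ∈ output P X ↔ q ∈ P ∧ Implies P S p q :=
  (isClosure_output hP hSP hp hpE h hf).mem_iff hP hc hSP hpE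
    (fun k hk => (((Sound.start hP hp hpE).run hP hSP hp hpE h Finset.Subset.rfl).1.biUnion_att
      hP hp hpE k hk).2) q

end Closure

end Algorithm

/-! ### Correctness and amortized cost of the table-driven version -/

section Implementation

open XPath Closure

variable {E A : Type*} [DecidableEq E] [DecidableEq A] {P C : Finset (XPath E A)}
  {S : Finset (XFD E A)} {p : XPath E A}

namespace Closure

/-! ### The deterministic implementation -/

theorem mem_candidates {k s : XPath E A} : (k, s, true) ∈ candidates P S ↔
    (∃ f ∈ S, (k <+: f.1 ∨ k <+: f.2) ∧ meet f.1 f.2 <+: k ∧ f.2 = s) ∨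
      (s ∈ P ∧ s.last.isAttr = true ∧ s.parnt = k) := by
  simp only [candidates, List.mem_append, List.mem_flatMap, List.mem_map, Finset.mem_toList,
    Prod.mk.injEq, List.mem_inits]
  refine or_congr ⟨?_, ?_⟩ ⟨?_, ?_⟩
  · rintro ⟨f, hf, k, hk, rfl, h1, h2⟩
    exact ⟨f, hf, hk, List.isPrefixOf_iff_prefix.1 h2, h1⟩
  · rintro ⟨f, hf, hk, h1, h2⟩
    exact ⟨f, hf, k, hk, rfl, h2, List.isPrefixOf_iff_prefix.2 h1⟩
  · rintro ⟨q, hq, h1, rfl, h2⟩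
    exact ⟨hq, h2, h1⟩
  · rintro ⟨hq, h1, h2⟩
    exact ⟨s, hq, h2, rfl, h1⟩

theorem length_candidates_le {L : ℕ} (hL : ∀ q ∈ P, q.labels.length ≤ L)
    (hSP : ∀ f ∈ S, f.1 ∈ P ∧ f.2 ∈ P) :
    (candidates P S).length ≤ 2 * L * S.card + P.card := by
  simp only [candidates, List.length_append, List.length_map, Finset.length_toList,
    List.length_flatMap, List.length_inits]
  gcongr
  have h : ∀ x ∈ S.toList.map fun f : XFD E A => f.1.length + 1 + (f.2.length + 1), x ≤ 2 * L := by
    simp only [List.mem_map, Finset.mem_toList]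
    rintro _ ⟨f, hf, rfl⟩
    have h1 := hL _ (hSP f hf).1
    have h2 := hL _ (hSP f hf).2
    simp only [labels, List.length_cons] at h1 h2
    omega
  have := List.sum_le_card_nsmul _ _ h
  simpa [mul_comm] using this

theorem card_le_of_prefix {L : ℕ} (hL : ∀ q ∈ P, q.labels.length ≤ L)
    (hSP : ∀ f ∈ S, f.1 ∈ P ∧ f.2 ∈ P) (hp : p ∈ P)
    (h : ∀ q ∈ P, q <+: p ∨ ∃ f ∈ S, q <+: f.1 ∨ q <+: f.2) :
    P.card ≤ L + S.card * (2 * L) := by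
  have hsub : P ⊆ p.inits.toFinset ∪ S.biUnion fun f => (f.1.inits ++ f.2.inits).toFinset := by
    intro q hq
    simpa using h q hq
  refine (Finset.card_le_card hsub).trans ((Finset.card_union_le _ _).trans ?_)
  gcongr
  · refine (List.toFinset_card_le _).trans ?_
    simpa [labels] using hL p hp
  · refine Finset.card_biUnion_le_card_mul _ _ _ fun f hf => (List.toFinset_card_le _).trans ?_
    have h1 := hL _ (hSP f hf).1
    have h2 := hL _ (hSP f hf).2
    simp only [labels, List.length_cons] at h1 h2
    simp only [List.length_append, List.length_inits]
    omega

/-- The invariant of the implementation. -/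
structure Config.Inv (P : Finset (XPath E A)) (S : Finset (XFD E A)) (p : XPath E A)
    (c : Config E A) : Prop where
  todo : ∀ e ∈ c.todo, e ∈ candidates P S
  table : ∀ k, ∀ s ∈ c.table k, (k, s, true) ∈ candidates P S
  table_complete : ∀ k s, (k, s, true) ∈ candidates P S → (k, s, true) ∈ c.todo ∨ s ∈ c.table k
  agenda : ∀ k ∈ c.agenda, k ∈ P ∧ Implies P S p k
  out : ∀ k ∈ c.out, k ∈ P ∧ Implies P S p k
  out_empty : c.todo ≠ [] → c.out = ∅
  mem_table : ∀ k ∈ c.out, ∀ s ∈ c.table k, s ∈ c.out ∨ s ∈ c.agenda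
  mem_parnt : ∀ k ∈ c.out, k.last.isElem = true → k.parnt ∈ c.out ∨ k.parnt ∈ c.agenda
  mem_self : p ∈ c.out ∨ p ∈ c.agenda
  mem_nil : [] ∈ c.out ∨ [] ∈ c.agenda

theorem Config.Inv.start (hP : IsPathSet P) (hp : p ∈ P) (hpE : p.last.isElem = true) :
    (Config.start P S p).Inv P S p := by
  refine ⟨fun e he => he, by simp [Config.start], fun k s h => .inl h, ?_, by simp [Config.start],
    fun _ => rfl, by simp [Config.start], by simp [Config.start], by simp [Config.start],
    by simp [Config.start]⟩
  intro k hk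
  simp only [Config.start, List.mem_cons, List.not_mem_nil, or_false] at hk
  rcases hk with rfl | rfl
  · exact ⟨hp, implies_self⟩
  · exact ⟨hP.prefix_mem p hp _ List.nil_prefix, implies_nil hpE⟩

theorem implies_of_mem_candidates (hP : IsPathSet P) (hSP : ∀ f ∈ S, f.1 ∈ P ∧ f.2 ∈ P)
    (hp : p ∈ P) (hpE : p.last.isElem = true) {k s : XPath E A}
    (h : (k, s, true) ∈ candidates P S) (hk : Implies P S p k) : s ∈ P ∧ Implies P S p s := by
  rcases mem_candidates.1 h with ⟨f, hf, h1, h2, rfl⟩ | ⟨hs, hsA, rfl⟩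
  · exact ⟨(hSP f hf).2, hk.rule hP hSP hpE hf h2 h1⟩
  · exact ⟨hs, hk.att hP hp hpE hs hsA⟩

theorem Config.Inv.step (hP : IsPathSet P) (hSP : ∀ f ∈ S, f.1 ∈ P ∧ f.2 ∈ P)
    (hp : p ∈ P) (hpE : p.last.isElem = true) {c : Config E A} (hc : c.Inv P S p) :
    c.step.Inv P S p := by
  obtain ⟨todo, table, agenda, out⟩ := c
  obtain ⟨h1, h2, h3, h4, h5, h6, h7, h8, h9, h10⟩ := hc
  dsimp only at h1 h2 h3 h4 h5 h6 h7 h8 h9 h10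
  match todo, agenda with
  | (k, s, b) :: t, g =>
    -- The table is finished before the first path enters `out`, so the invariants about `out` hold
    -- vacuously while the table grows.
    obtain rfl : out = ∅ := h6 (by simp)
    have ht : ∀ k' s', s' ∈ (if b = true then Function.update table k (s :: table k)
        else table) k' ↔ s' ∈ table k' ∨ (b = true ∧ k' = k ∧ s' = s) := by
      intro k' s'
      split_ifs with hb
      · by_cases e : k' = k
        · subst e; simp [hb, or_comm]
        · simp [e]
      · simp [hb]
    refine ⟨fun e he => h1 e (List.mem_cons_of_mem _ he), ?_, ?_, h4, h5, fun _ => rfl, ?_, ?_,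
      h9, h10⟩
    · intro k' s' hs'
      rcases (ht k' s').1 hs' with h | ⟨rfl, rfl, rfl⟩
      · exact h2 k' s' h
      · exact h1 _ List.mem_cons_self
    · intro k' s' h
      change _ ∈ t ∨ s' ∈ (if b = true then Function.update table k (s :: table k) else table) k'
      rw [ht]
      rcases h3 k' s' h with h | h
      · rcases List.mem_cons.1 h with h | h
        · simp only [Prod.mk.injEq] at h
          exact .inr (.inr ⟨h.2.2.symm, h.1, h.2.1⟩)
        · exact .inl h
      · exact .inr (.inl h)
    · rintro k' hk'
      exact absurd hk' (Finset.notMem_empty _)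
    · rintro k' hk'
      exact absurd hk' (Finset.notMem_empty _)
  | [], q :: g =>
    by_cases hq : q ∈ out
    · have e : Config.step ⟨[], table, q :: g, out⟩ = ⟨[], table, g, out⟩ := by
        simp [Config.step, hq]
      rw [e]
      have hg : ∀ {k}, k ∈ out ∨ k ∈ q :: g → k ∈ out ∨ k ∈ g := by
        intro k hk
        rcases hk with h | h
        · exact .inl h
        · rcases List.mem_cons.1 h with rfl | h
          · exact .inl hq
          · exact .inr h
      exact ⟨h1, h2, h3, fun k hk => h4 k (List.mem_cons_of_mem _ hk), h5, h6,
        fun k hk s hs => hg (h7 k hk s hs), fun k hk hE => hg (h8 k hk hE), hg h9, hg h10⟩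
    · have e : Config.step ⟨[], table, q :: g, out⟩ = ⟨[], table,
          (if q.last.isElem = true then [q.parnt] else []) ++ table q ++ g, insert q out⟩ := by
        simp [Config.step, hq]
      rw [e]
      have hqs := h4 q List.mem_cons_self
      have hg : ∀ {k}, k ∈ out ∨ k ∈ q :: g → k ∈ insert q out ∨
          k ∈ (if q.last.isElem = true then [q.parnt] else []) ++ table q ++ g := by
        intro k hk
        simp only [Finset.mem_insert, List.mem_append, List.mem_cons] at hk ⊢
        tauto
      refine ⟨h1, h2, h3, ?_, ?_, fun h => absurd rfl h, ?_, ?_, hg h9, hg h10⟩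
      · intro k hk
        simp only [List.mem_append] at hk
        rcases hk with (hk | hk) | hk
        · split_ifs at hk with hE
          · rw [List.mem_singleton] at hk
            subst hk
            exact ⟨hP.prefix_mem q hqs.1 _ (parnt_prefix q),
              hqs.2.prefix hpE hqs.1 hE (parnt_prefix q)⟩
          · simp at hk
        · exact implies_of_mem_candidates hP hSP hp hpE (h2 q k hk) hqs.2
        · exact h4 k (List.mem_cons_of_mem _ hk)
      · intro k hk
        rcases Finset.mem_insert.1 hk with rfl | hk
        · exact hqs
        · exact h5 k hk
      · intro k hk s hs
        rcases Finset.mem_insert.1 hk with rfl | hk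
        · exact .inr (by simp only [List.mem_append]; tauto)
        · exact hg (h7 k hk s hs)
      · intro k hk hE
        rcases Finset.mem_insert.1 hk with rfl | hk
        · exact .inr (by simp [hE])
        · exact hg (h8 k hk hE)
  | [], [] => exact ⟨h1, h2, h3, h4, h5, h6, h7, h8, h9, h10⟩

theorem Config.Inv.isClosure {c : Config E A} (hc : c.Inv P S p) (hh : c.Halted) :
    IsClosure P S p c.out := by
  obtain ⟨ht, ha⟩ := hh
  have hout : ∀ {k}, k ∈ c.out ∨ k ∈ c.agenda → k ∈ c.out := by simp [ha]
  have htab : ∀ {k s}, (k, s, true) ∈ candidates P S → k ∈ c.out → s ∈ c.out := by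
    intro k s h hk
    exact hout (hc.mem_table k hk s ((hc.table_complete k s h).resolve_left (by simp [ht])))
  exact ⟨fun k hk => (hc.out k hk).1, hout hc.mem_self, hout hc.mem_nil,
    fun k hk hE => hout (hc.mem_parnt k hk hE),
    fun k hk hA hk' => htab (mem_candidates.2 (.inr ⟨hk, hA, rfl⟩)) hk',
    fun f hf k hk h1 h2 => htab (mem_candidates.2 (.inl ⟨f, hf, h2, h1, rfl⟩)) hk⟩

/-- A bound for the number of steps that remain. -/
def Config.potential (P : Finset (XPath E A)) (c : Config E A) : ℕ :=
  2 * c.todo.length + c.agenda.length + ∑ k ∈ P \ c.out, ((c.table k).length + 1)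

/-- A candidate has weight 2: one unit pays for its step, the other is stored with the table entry
it may create. A path outside `out` holds one unit per table entry and one for its parent, which pay
for the agenda items pushed on its insertion; the handled agenda item pays for the step. -/
theorem Config.potential_step {c : Config E A} (hc : ∀ k ∈ c.agenda, k ∈ P) (hh : ¬ c.Halted) :
    c.step.potential P < c.potential P := by
  obtain ⟨todo, table, agenda, out⟩ := c
  match todo, agenda with
  | (k, s, b) :: t, g =>
    have h : ∑ k' ∈ P \ out, (((if b = true then Function.update table k (s :: table k)
        else table) k').length + 1) ≤ ∑ k' ∈ P \ out, ((table k').length + 1) + 1 := by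
      have : ∀ k', ((if b = true then Function.update table k (s :: table k)
          else table) k').length + 1 ≤ ((table k').length + 1) + if k' = k then 1 else 0 := by
        intro k'
        split_ifs with h1 h2 h2
        · subst h2; simp
        · simp [h2]
        · simp
        · simp
      refine (Finset.sum_le_sum fun k' _ => this k').trans ?_
      rw [Finset.sum_add_distrib, Finset.sum_ite_eq']
      split_ifs <;> omega
    simp only [Config.potential, Config.step, List.length_cons]
    omega
  | [], q :: g =>
    by_cases hq : q ∈ out
    · simp [Config.potential, Config.step, hq]
    · have hqP : q ∈ P \ out := Finset.mem_sdiff.2 ⟨hc q List.mem_cons_self, hq⟩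
      have hE : (if q.last.isElem = true then [q.parnt] else []).length ≤ 1 := by
        split_ifs <;> simp
      have hs := Finset.add_sum_erase (P \ out) (fun k => (table k).length + 1) hqP
      simp only [Config.potential, Config.step, hq, if_false, List.length_append, List.length_cons,
        ← Finset.erase_sdiff_comm, Finset.sdiff_insert] at hs ⊢
      omega
  | [], [] => exact absurd ⟨rfl, rfl⟩ hh

theorem Config.Halted.step_eq {c : Config E A} (hh : c.Halted) : c.step = c := by
  obtain ⟨todo, table, agenda, out⟩ := c
  obtain ⟨h1, h2⟩ := hh
  dsimp only at h1 h2
  subst h1 h2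
  rfl

theorem Config.Inv.iterate (hP : IsPathSet P) (hSP : ∀ f ∈ S, f.1 ∈ P ∧ f.2 ∈ P)
    (hp : p ∈ P) (hpE : p.last.isElem = true) {n : ℕ} {c : Config E A} (hc : c.Inv P S p)
    (hn : c.potential P ≤ n) :
    (Config.step^[n] c).Halted ∧ (Config.step^[n] c).Inv P S p := by
  induction n generalizing c with
  | zero =>
    refine ⟨?_, hc⟩
    by_contra hh
    have := Config.potential_step (fun k hk => (hc.agenda k hk).1) hh
    omega
  | succ n ih =>
    by_cases hh : c.Halted
    · rw [Function.iterate_fixed hh.step_eq]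
      exact ⟨hh, hc⟩
    · rw [Function.iterate_succ_apply]
      have := Config.potential_step (fun k hk => (hc.agenda k hk).1) hh
      exact ih (hc.step hP hSP hp hpE) (by omega)

theorem Config.potential_start {L : ℕ} (hL : ∀ q ∈ P, q.labels.length ≤ L)
    (hSP : ∀ f ∈ S, f.1 ∈ P ∧ f.2 ∈ P) :
    (Config.start P S p).potential P ≤ 4 * L * S.card + 3 * P.card + 2 := by
  have := length_candidates_le hL hSP
  simp only [Config.potential, Config.start, List.length_cons, List.length_nil, Finset.sdiff_empty,
    Finset.sum_const, smul_eq_mul]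
  linarith

end Closure

end Implementation

/-! ### The main theorem -/

theorem mainTheorem3 {E A : Type*} [DecidableEq E] [DecidableEq A]
    (P : Finset (XPath E A)) (hP : IsPathSet P) (hc : LabelConsistent P)
    (S : Finset (XFD E A)) (hS : ∀ f ∈ S, f.1 ∈ P ∧ f.2 ∈ P)
    (p : XPath E A) (hp : p ∈ P) (hpE : p.last.isElem = true) :
    -- termination: every run uses at most `|S|` XFDs, and some run is finished
    (∀ n X, Closure.Run P n (Closure.start P S p) X → n ≤ S.card) ∧
    (∃ n X, Closure.Run P n (Closure.start P S p) X ∧ Closure.Finished P S X) ∧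
    -- correctness: whatever choices are made, the output is the closure of `p`
    (∀ n X, Closure.Run P n (Closure.start P S p) X → Closure.Finished P S X →
      ∀ q, q ∈ Closure.output P X ↔ q ∈ P ∧ Implies P S p q) ∧
    -- the deterministic implementation computes the closure in linearly many steps
    (∀ L : ℕ, (∀ q ∈ P, q.labels.length ≤ L) →
      ∃ n : ℕ, n ≤ 4 * L * S.card + 3 * P.card + 2 ∧
        ((∀ q ∈ P, q <+: p ∨ ∃ f ∈ S, q <+: f.1 ∨ q <+: f.2) → n ≤ 10 * L * (S.card + 1)) ∧
        (Closure.Config.step^[n] (Closure.Config.start P S p)).Halted ∧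
        ∀ q, q ∈ (Closure.Config.step^[n] (Closure.Config.start P S p)).out ↔
          q ∈ P ∧ Implies P S p q) := by
  refine ⟨?_, ?_, ?_, ?_⟩
  · intro n X h
    have := h.card
    simp only [Closure.start] at this
    omega
  · exact Closure.exists_finished S _ _ rfl (.refl _)
  · intro n X h hf q
    exact Closure.output_iff hP hc hS hp hpE h hf q
  · intro L hL
    obtain ⟨hh, hi⟩ := (Closure.Config.Inv.start (S := S) hP hp hpE).iterate hP hS hp hpE
      (Closure.Config.potential_start hL hS)
    -- The bound itself serves as `n`, since halted configurations are fixed by `step`.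
    refine ⟨_, le_rfl, fun h => ?_, hh, (hi.isClosure hh).mem_iff hP hc hS hpE
      fun k hk => (hi.out k hk).2⟩
    have h1 := Closure.card_le_of_prefix hL hS hp h
    have h2 : 1 ≤ L := le_trans (by simp [XPath.labels]) (hL p hp)
    -- With `|P| ≤ L + 2L|S|` the bound is at most `10L|S| + 3L + 2`, and `3L + 2 ≤ 10L` because `L
    -- ≥ 1`.
    nlinarith
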